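/- All graphs are finite and simple. A graph is $k$-connected if it has more than $k$ vertices and remains connected after the deletion of any set of fewer than $k$ vertices. Let $\omega(G)$ be the number of connected components of $G$. The toughness of $G$ is $t(G)=\min\{|X|/\omega(G-X): X\subseteq V(G),\ \omega(G-X)\ge 2\}$ if $G$ is not complete, and $t(G)=+\infty$ if $G$ is complete. A $P_{\ge 3}$-factor of $G$ is a spanning subgraph of $G$ each of whose components is a path with at least $3$ vertices. A graph $G$ is $(P_{\ge 3},n)$-factor critical avoidable if for every $W\subseteq V(G)$ with $|W|=n$ and every edge $e$ of $G-W$, the graph $G-W$ has a $P_{\ge 3}$-factor that does not contain $e$. Let $G_1+G_2$ denote the join of $G_1$ and $G_2$ (their disjoint union together with all edges between them). **Theorem.** Let $n,r\ge 0$ be integers. 1. If $G$ is an $(n+r+2)$-connected graph with $t(G)>\frac{n+r+2}{2(r+2)}$, then $G$ is $(P_{\ge 3},n)$-factor critical avoidable. 2. The toughness condition is sharp: the graph $G=K_{n+r+2}+\big((2r+3)K_1\cup K_2\big)$ is $(n+r+2)$-connected and $t(G)=\frac{n+r+2}{2(r+2)}$, but $G$ is not $(P_{\ge 3},n)$-factor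 critical avoidable. 3. The connectivity condition cannot be weakened to $(n+r+1)$-connectedness when $n\ge 1$: the graph $G=K_{n+r+1}+\big((2r+1)K_1\cup K_2\big)$ is $(n+r+1)$-connected and $t(G)=\frac{n+r+1}{2r+2}>\frac{n+r+2}{2(r+2)}$, but $G$ is not $(P_{\ge 3},n)$-factor critical avoidable. -/

import Mathlib

open scoped ENNReal

namespace PathFactor

/-- `G - X`: the graph obtained from `G` by removing the vertices in `X`. -/
abbrev deleteVerts {V : Type*} (G : SimpleGraph V) (X : Finset V) :
    SimpleGraph ((X : Set V)ᶜ : Set V) :=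
  G.induce ((X : Set V)ᶜ)

/-- `ω(G)`: the number of connected components of a finite graph. -/
noncomputable def numComponents {V : Type*} (G : SimpleGraph V) : ℕ :=
  Nat.card G.ConnectedComponent

/-- `G` is `k`-connected: it has more than `k` vertices and stays connected whenever fewer than
`k` vertices are removed. -/
def IsVertexConnected {V : Type*} [Fintype V] (G : SimpleGraph V) (k : ℕ) : Prop :=
  k < Fintype.card V ∧ ∀ X : Finset V, X.card < k → (deleteVerts G X).Connected

/-- The toughness `t(G)`: the minimum of `|X| / ω(G - X)` over the vertex subsets `X` with
`ω(G - X) ≥ 2`. If `G` is complete there is no such `X`, and the infimum is `∞`. -/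
noncomputable def toughness {V : Type*} [Fintype V] (G : SimpleGraph V) : ℝ≥0∞ :=
  ⨅ (X : Finset V) (_ : 2 ≤ numComponents (deleteVerts G X)),
    (X.card : ℝ≥0∞) / (numComponents (deleteVerts G X) : ℝ≥0∞)

/-- `F` is a `P_{≥k}`-factor of `G`: a spanning subgraph (same vertex set, `F ≤ G`) each of whose
connected components is a path with at least `k` vertices. -/
def IsPathFactor {V : Type*} (G F : SimpleGraph V) (k : ℕ) : Prop :=
  F ≤ G ∧ ∀ C : F.ConnectedComponent,
    ∃ m : ℕ, k ≤ m ∧ Nonempty (C.toSimpleGraph ≃g SimpleGraph.pathGraph m)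

/-- `G` is `P_{≥k}`-factor avoidable: for every edge `e` it has a `P_{≥k}`-factor avoiding `e`. -/
def IsPathFactorAvoidable {V : Type*} (G : SimpleGraph V) (k : ℕ) : Prop :=
  ∀ e ∈ G.edgeSet, ∃ F : SimpleGraph V, IsPathFactor G F k ∧ e ∉ F.edgeSet

/-- `G` is `(P_{≥k}, n)`-factor critical avoidable: `G - W` is `P_{≥k}`-factor avoidable for every
set `W` of exactly `n` vertices. -/
def IsPathFactorCriticalAvoidable {V : Type*} (G : SimpleGraph V) (k n : ℕ) : Prop :=
  ∀ W : Finset V, W.card = n → IsPathFactorAvoidable (deleteVerts G W) k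

/-- The join of two graphs: their disjoint union together with all edges between them. -/
def join {V W : Type*} (G : SimpleGraph V) (H : SimpleGraph W) : SimpleGraph (V ⊕ W) :=
  (G.sum H) ⊔ completeBipartiteGraph V W

/-- The join of `K_a` with the disjoint union of `b` isolated vertices and one `K_2`. -/
def extremalGraph (a b : ℕ) : SimpleGraph (Fin a ⊕ (Fin b ⊕ Fin 2)) :=
  join (⊤ : SimpleGraph (Fin a))
    ((⊥ : SimpleGraph (Fin b)).sum (⊤ : SimpleGraph (Fin 2)))

end PathFactor

/-!
A sun is a single vertex or a corona: a factor-critical graph with a pendant edge attached to each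
of its vertices. By Kaneko's theorem a graph has a `P_{≥3}`-factor if deleting any vertex set `S`
leaves at most `2 |S|` sun components.

Kaneko's theorem is proved by induction on the number of vertices plus edges. If some nonempty `S`
attains equality, Hall's theorem assigns two adjacent suns to each vertex of `S`; a vertex together
with its two suns is covered by paths, and the rest satisfies the condition again. If the count
misses `2 |S|` by at least two for every nonempty `S`, any edge can be deleted. In the remaining
case take a largest `S` that misses equality by one. A component that is not a sun supplies the
missing second sun. If there is no such component, one sun can be made to serve two vertices of
`S`, unless the whole graph is a corona over a core of odd order; such a core contains a set whose
deletion leaves too many factor-critical components, and that contradicts the condition.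

For the positive part of the theorem, the condition is checked for `G - W - e`. Deleting `e` creates
at most one new component. So a set `S ≠ ∅` violating the condition has `ω(G - W - S) ≥ 2 |S|`;
connectivity forces `|S| ≥ r + 2`, and then
`|W ∪ S| / ω(G - W - S) ≤ (n + |S|) / (2 |S|) ≤ (n + r + 2) / (2 (r + 2))`. In the extremal graphs,
after the removal of `n` vertices of the complete part, too few of its vertices remain to be
adjacent to all the independent vertices in a graph of maximum degree two.
-/

namespace PathFactor

section Covers

variable {V : Type*} [DecidableEq V] {G G' : SimpleGraph V}

/-- The finite vertex set can be partitioned into vertex sets of paths of `G` with at least three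
vertices; this is a `P_{≥3}`-factor of the induced graph, with each path given by the list of its
vertices. -/
inductive HasPathCover (G : SimpleGraph V) : Finset V → Prop
  | empty : HasPathCover G ∅
  | cons {U : Finset V} (l : List V) (hchain : l.IsChain G.Adj) (hnodup : l.Nodup)
      (hlen : 3 ≤ l.length) (hdisj : Disjoint l.toFinset U) (hU : HasPathCover G U) :
      HasPathCover G (l.toFinset ∪ U)

/-- The graph induced by `G` on the finite vertex set has a perfect matching. -/
inductive HasMatching (G : SimpleGraph V) : Finset V → Prop
  | empty : HasMatching G ∅
  | cons {U : Finset V} {x y : V} (hxy : G.Adj x y) (hx : x ∉ U) (hy : y ∉ U)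
      (hU : HasMatching G U) : HasMatching G (insert x (insert y U))

theorem HasPathCover.mono (hG : G ≤ G') {U : Finset V} (h : HasPathCover G U) :
    HasPathCover G' U := by
  induction h with
  | empty => exact .empty
  | cons l hchain hnodup hlen hdisj _ ih =>
    exact .cons l (hchain.imp fun _ _ h => hG h) hnodup hlen hdisj ih

theorem HasPathCover.union {A B : Finset V} (hA : HasPathCover G A) (hB : HasPathCover G B)
    (hAB : Disjoint A B) : HasPathCover G (A ∪ B) := by
  induction hA with
  | empty => simpa using hB
  | cons l hchain hnodup hlen hdisj _ ih =>
    rw [Finset.disjoint_union_left] at hAB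
    rw [Finset.union_assoc]
    exact .cons l hchain hnodup hlen (Finset.disjoint_union_right.2 ⟨hdisj, hAB.1⟩) (ih hAB.2)

theorem HasPathCover.of_sdiff {A B : Finset V} (hA : HasPathCover G A)
    (hB : HasPathCover G (B \ A)) (h : A ⊆ B) : HasPathCover G B :=
  Finset.union_sdiff_of_subset h ▸ hA.union hB Finset.disjoint_sdiff

theorem HasPathCover.of_path {U : Finset V} (l : List V) (hchain : l.IsChain G.Adj)
    (hnodup : l.Nodup) (hlen : 3 ≤ l.length) (hl : ∀ x ∈ l, x ∈ U)
    (hU : HasPathCover G (U \ l.toFinset)) : HasPathCover G U := by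
  have hlU : l.toFinset ⊆ U := fun x hx => hl x (List.mem_toFinset.1 hx)
  exact Finset.union_sdiff_of_subset hlU ▸ .cons l hchain hnodup hlen Finset.disjoint_sdiff hU

theorem HasPathCover.biUnion {ι : Type*} (s : Finset ι) (f : ι → Finset V)
    (h : ∀ i ∈ s, HasPathCover G (f i))
    (hd : ∀ i ∈ s, ∀ j ∈ s, i ≠ j → Disjoint (f i) (f j)) : HasPathCover G (s.biUnion f) := by
  classical
  induction s using Finset.induction_on with
  | empty => exact .empty
  | insert i s hi ih =>
    rw [Finset.biUnion_insert]
    refine (h i (by simp)).union (ih (fun j hj => h j (by simp [hj]))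
      (fun j hj k hk => hd j (by simp [hj]) k (by simp [hk]))) ?_
    rw [Finset.disjoint_biUnion_right]
    exact fun j hj => hd i (by simp) j (by simp [hj]) (ne_of_mem_of_not_mem hj hi).symm

theorem HasPathCover.preimage {W : Type*} [DecidableEq W] (f : W → V)
    (hf : Function.Injective f) {U : Finset V} (h : HasPathCover G U)
    (hU : ∀ x ∈ U, ∃ w, f w = x) : HasPathCover (G.comap f) (U.preimage f hf.injOn) := by
  induction h with
  | empty => simpa using HasPathCover.empty
  | @cons U l hchain hnodup hlen hdisj _ ih =>
    obtain ⟨m, rfl⟩ : l ∈ Set.range (List.map f) := by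
      rw [Set.range_list_map]
      exact fun x hx => hU x (by simp [hx])
    have hmem (x : W) : f x ∈ List.map f m ↔ x ∈ m := by simp [hf.eq_iff]
    have hdisj' (x : W) (hx : f x ∈ U) : x ∉ m := fun hxm =>
      Finset.disjoint_left.1 hdisj (by simpa using (hmem x).2 hxm) hx
    refine .of_path m ((List.isChain_map f).1 hchain) (hnodup.of_map _) (by simpa using hlen)
      (fun x hx => by
        simp only [Finset.mem_preimage, Finset.mem_union, List.mem_toFinset, hmem, hx, true_or]) ?_
    convert ih (fun x hx => hU x (by simp [hx])) using 1
    ext x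
    simp only [Finset.mem_sdiff, Finset.mem_preimage, Finset.mem_union, List.mem_toFinset, hmem]
    grind

theorem HasMatching.congr {U : Finset V} (h : HasMatching G U)
    (hG : ∀ x ∈ U, ∀ y ∈ U, G.Adj x y → G'.Adj x y) : HasMatching G' U := by
  induction h with
  | empty => exact .empty
  | cons hxy hx hy _ ih =>
    exact .cons (hG _ (by simp) _ (by simp) hxy) hx hy
      (ih fun a ha b hb => hG a (by simp [ha]) b (by simp [hb]))

theorem HasMatching.even {U : Finset V} (h : HasMatching G U) : Even U.card := by
  induction h with
  | empty => simp
  | cons hxy hx hy _ ih =>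
    rw [Finset.card_insert_of_notMem (by simp [hx, hxy.ne]), Finset.card_insert_of_notMem hy]
    simpa [Nat.even_add_one] using ih

theorem HasMatching.exists_partner {U : Finset V} (h : HasMatching G U) {z : V} (hz : z ∈ U) :
    ∃ w ∈ U, G.Adj z w ∧ HasMatching G (U \ {z, w}) := by
  induction h with
  | empty => simp at hz
  | @cons U x y hxy hx hy hU ih =>
    have hne := hxy.ne
    rcases eq_or_ne z x with rfl | hzx
    · exact ⟨y, by simp, hxy, by convert hU using 1; grind⟩
    rcases eq_or_ne z y with rfl | hzy
    · exact ⟨x, by simp, hxy.symm, by convert hU using 1; grind⟩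
    obtain ⟨w, hw, hzw, hrest⟩ := ih (by simpa [hzx, hzy] using hz)
    refine ⟨w, by simp [hw], hzw, ?_⟩
    convert HasMatching.cons hxy (by simp [hx]) (by simp [hy]) hrest using 1
    grind

/-- There is a path that starts at `s`, continues with at least one vertex of `C` and stays in `C`,
such that the rest of `C` has a path cover. Gluing two such arms at `s` gives a path on at least
three vertices. -/
def HasArm (G : SimpleGraph V) (s : V) (C : Finset V) : Prop :=
  ∃ l : List V, l ≠ [] ∧ (s :: l).IsChain G.Adj ∧ l.Nodup ∧ (∀ x ∈ l, x ∈ C) ∧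
    HasPathCover G (C \ l.toFinset)

theorem HasArm.singleton {s a : V} (h : G.Adj s a) : HasArm G s {a} :=
  ⟨[a], by simp, by simpa using h, by simp, by simp, by simpa using HasPathCover.empty⟩

theorem HasArm.of_sdiff_pair {s z w : V} {C : Finset V} (hsz : G.Adj s z) (hzw : G.Adj z w)
    (hz : z ∈ C) (hw : w ∈ C) (hC : HasPathCover G (C \ {z, w})) : HasArm G s C :=
  ⟨[z, w], by simp, by simp [hsz, hzw], by simp [hzw.ne], by simp [hz, hw], by simpa using hC⟩

theorem HasArm.pair {s z w : V} (hsz : G.Adj s z) (hzw : G.Adj z w) : HasArm G s {z, w} :=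
  .of_sdiff_pair hsz hzw (by simp) (by simp) (by simpa using HasPathCover.empty)

theorem HasArm.cons {a t : V} {C : Finset V} (hat : G.Adj a t) (ht : t ∉ C) (hC : HasArm G t C) :
    HasArm G a (insert t C) := by
  obtain ⟨l, -, hchain, hnodup, hmem, hrest⟩ := hC
  refine ⟨t :: l, by simp, by simpa [hat] using hchain,
    List.nodup_cons.2 ⟨fun htl => ht (hmem t htl), hnodup⟩, by grind, ?_⟩
  convert hrest using 1
  grind [List.mem_toFinset]

theorem HasArm.union {s : V} {C D : Finset V} (hC : HasArm G s C) (hD : HasPathCover G D)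
    (hCD : Disjoint C D) : HasArm G s (C ∪ D) := by
  obtain ⟨l, hne, hchain, hnodup, hmem, hrest⟩ := hC
  refine ⟨l, hne, hchain, hnodup, by grind, ?_⟩
  convert hrest.union hD (hCD.mono_left Finset.sdiff_subset) using 1
  grind [List.mem_toFinset, Finset.disjoint_left]

theorem HasPathCover.of_arms {s : V} {C D : Finset V} (hC : HasArm G s C) (hD : HasArm G s D)
    (hCD : Disjoint C D) (hsC : s ∉ C) (hsD : s ∉ D) : HasPathCover G (insert s (C ∪ D)) := by
  obtain ⟨l, hl, hlchain, hlnodup, hlC, hlrest⟩ := hC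
  obtain ⟨m, hm, hmchain, hmnodup, hmD, hmrest⟩ := hD
  have hchain : (l.reverse ++ s :: m).IsChain G.Adj := by
    rw [List.isChain_split, ← List.reverse_cons, List.isChain_reverse]
    exact ⟨hlchain.imp fun _ _ h => h.symm, hmchain⟩
  have hnodup : (l.reverse ++ s :: m).Nodup := by
    grind [List.nodup_append, List.nodup_reverse, Finset.disjoint_left]
  have hlen : 3 ≤ (l.reverse ++ s :: m).length := by
    have := List.length_pos_iff.2 hl
    have := List.length_pos_iff.2 hm
    simp only [List.length_append, List.length_reverse, List.length_cons]
    omega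
  refine .of_path _ hchain hnodup hlen (by grind) ?_
  convert hlrest.union hmrest (hCD.mono Finset.sdiff_subset Finset.sdiff_subset) using 1
  grind [List.mem_toFinset, Finset.disjoint_left]

end Covers

section Suns

variable {V : Type*} [DecidableEq V] {G G' : SimpleGraph V}

/-- The graph induced by `G` on `C` is the corona of the graph induced on `R`: every `v ∈ R` has
exactly one pendant neighbour `p v`, and `C` consists of `R` and these neighbours. -/
structure IsCorona (G : SimpleGraph V) (C R : Finset V) (p : V → V) : Prop where
  eq_union : C = R ∪ R.image p
  leaf_notMem : ∀ v ∈ R, p v ∉ R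
  injOn : Set.InjOn p R
  adj_leaf : ∀ v ∈ R, G.Adj v (p v)
  eq_of_leaf_adj : ∀ v ∈ R, ∀ y ∈ C, G.Adj (p v) y → y = v

/-- The graph induced by `G` on `R` is factor-critical: it is nonempty and has a perfect matching
after the removal of any vertex. -/
def IsFactorCritical (G : SimpleGraph V) (R : Finset V) : Prop :=
  R.Nonempty ∧ ∀ v ∈ R, HasMatching G (R.erase v)

/-- `G` induces a sun on `C`: a single vertex, or the corona of a factor-critical graph
(`K₂` being the corona of `K₁`). -/
def IsSun (G : SimpleGraph V) (C : Finset V) : Prop :=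
  (∃ v, C = {v}) ∨ ∃ R p, IsCorona G C R p ∧ IsFactorCritical G R

theorem IsFactorCritical.odd_card {R : Finset V} (h : IsFactorCritical G R) : Odd R.card := by
  obtain ⟨v, hv⟩ := h.1
  exact Finset.card_erase_add_one hv ▸ (h.2 v hv).even.add_one

theorem IsFactorCritical.congr {R : Finset V} (h : IsFactorCritical G R)
    (hG : ∀ x ∈ R, ∀ y ∈ R, G.Adj x y → G'.Adj x y) : IsFactorCritical G' R :=
  ⟨h.1, fun v hv => (h.2 v hv).congr fun x hx y hy =>
    hG x (Finset.mem_of_mem_erase hx) y (Finset.mem_of_mem_erase hy)⟩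

theorem IsFactorCritical.exists_adj_hasMatching {R : Finset V} (h : IsFactorCritical G R) {v z : V}
    (hv : v ∈ R) (hz : z ∈ R) (hzv : z ≠ v) :
    ∃ w ∈ R, w ≠ v ∧ w ≠ z ∧ G.Adj z w ∧ HasMatching G (R \ {v, z, w}) := by
  obtain ⟨w, hw, hzw, hrest⟩ := (h.2 v hv).exists_partner (z := z) (by simp [hz, hzv])
  rw [Finset.mem_erase] at hw
  refine ⟨w, hw.2, hw.1, hzw.ne.symm, hzw, ?_⟩
  convert hrest using 1
  grind

namespace IsCorona

variable {C R : Finset V} {p : V → V}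

theorem mem_of_mem_core (h : IsCorona G C R p) {v : V} (hv : v ∈ R) : v ∈ C := by
  rw [h.eq_union]
  exact Finset.mem_union_left _ hv

theorem leaf_mem (h : IsCorona G C R p) {v : V} (hv : v ∈ R) : p v ∈ C := by
  rw [h.eq_union]
  exact Finset.mem_union_right _ (Finset.mem_image_of_mem p hv)

theorem exists_eq_or_eq_leaf (h : IsCorona G C R p) {x : V} (hx : x ∈ C) :
    ∃ v ∈ R, x = v ∨ x = p v := by
  rw [h.eq_union, Finset.mem_union, Finset.mem_image] at hx
  rcases hx with hx | ⟨v, hv, rfl⟩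
  · exact ⟨x, hx, .inl rfl⟩
  · exact ⟨v, hv, .inr rfl⟩

theorem ne_leaf (h : IsCorona G C R p) {v w : V} (hv : v ∈ R) (hw : w ∈ R) : v ≠ p w :=
  ne_of_mem_of_not_mem hv (h.leaf_notMem w hw)

theorem leaf_ne_leaf (h : IsCorona G C R p) {v w : V} (hv : v ∈ R) (hw : w ∈ R) (hvw : v ≠ w) :
    p v ≠ p w :=
  h.injOn.ne hv hw hvw

theorem card_eq (h : IsCorona G C R p) : C.card = 2 * R.card := by
  have hdisj : Disjoint R (R.image p) := by
    grind [Finset.disjoint_left, h.leaf_notMem]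
  rw [h.eq_union, Finset.card_union_of_disjoint hdisj, Finset.card_image_of_injOn h.injOn, two_mul]

theorem congr (h : IsCorona G C R p) (hG : ∀ x ∈ C, ∀ y ∈ C, (G.Adj x y ↔ G'.Adj x y)) :
    IsCorona G' C R p where
  eq_union := h.eq_union
  leaf_notMem := h.leaf_notMem
  injOn := h.injOn
  adj_leaf v hv := (hG _ (h.mem_of_mem_core hv) _ (h.leaf_mem hv)).1 (h.adj_leaf v hv)
  eq_of_leaf_adj v hv y hy hvy := h.eq_of_leaf_adj v hv y hy ((hG _ (h.leaf_mem hv) _ hy).2 hvy)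

-- Each matching edge `xy` of the core extends to the path `p x, x, y, p y`.
theorem hasPathCover_of_hasMatching (h : IsCorona G C R p) {M : Finset V} (hM : HasMatching G M)
    (hMR : M ⊆ R) : HasPathCover G (M ∪ M.image p) := by
  induction hM with
  | empty => simpa using HasPathCover.empty
  | @cons U x y hxy hx hy _ ih =>
    have hxR : x ∈ R := hMR (by simp)
    have hyR : y ∈ R := hMR (by simp)
    have hUR : U ⊆ R := fun a ha => hMR (by simp [ha])
    have hmem_image {v : V} (hv : v ∈ R) : p v ∈ U.image p ↔ v ∈ U :=
      Finset.mem_image.trans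
        ⟨fun ⟨u, hu, hup⟩ => h.injOn (hUR hu) hv hup ▸ hu, fun hvU => ⟨v, hvU, rfl⟩⟩
    have hnotMem_image {v : V} (hv : v ∈ R) : v ∉ U.image p := fun hvU => by
      obtain ⟨u, hu, rfl⟩ := Finset.mem_image.1 hvU
      exact h.leaf_notMem u (hUR hu) hv
    have hleaf_notMem {v : V} (hv : v ∈ R) : p v ∉ U := fun hvU => h.leaf_notMem v hv (hUR hvU)
    have hsplit : (insert x (insert y U) ∪ (insert x (insert y U)).image p) =
        [p x, x, y, p y].toFinset ∪ (U ∪ U.image p) := by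
      ext a
      simp only [Finset.image_insert, Finset.mem_union, Finset.mem_insert, List.mem_toFinset,
        List.mem_cons, List.not_mem_nil]
      tauto
    have hnodup : [p x, x, y, p y].Nodup := by
      grind [h.ne_leaf hxR hxR, h.ne_leaf hyR hxR, h.ne_leaf hxR hyR, h.ne_leaf hyR hyR,
        h.leaf_ne_leaf hxR hyR hxy.ne, hxy.ne]
    rw [hsplit]
    refine .cons _ ?_ hnodup (by simp) ?_ (ih hUR)
    · simp [(h.adj_leaf x hxR).symm, hxy, h.adj_leaf y hyR]
    · simp [hmem_image, hnotMem_image, hleaf_notMem, hxR, hyR, hx, hy]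

theorem hasPathCover_sdiff (h : IsCorona G C R p) {T : Finset V} (hT : T ⊆ R)
    (hM : HasMatching G (R \ T)) : HasPathCover G (C \ (T ∪ T.image p)) := by
  convert h.hasPathCover_of_hasMatching hM Finset.sdiff_subset using 1
  ext a
  rw [h.eq_union]
  simp only [Finset.mem_sdiff, Finset.mem_union, Finset.mem_image, not_or, not_exists, not_and]
  constructor
  · rintro ⟨ha | ⟨v, hv, rfl⟩, haT, haT'⟩
    · exact .inl ⟨ha, haT⟩
    · exact .inr ⟨v, ⟨hv, fun hvT => haT' v hvT rfl⟩, rfl⟩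
  · rintro (⟨ha, haT⟩ | ⟨v, ⟨hv, hvT⟩, rfl⟩)
    · exact ⟨.inl ha, haT, fun v hv hva => h.leaf_notMem v (hT hv) (hva ▸ ha)⟩
    · exact ⟨.inr ⟨v, hv, rfl⟩, fun hpT => h.leaf_notMem v hv (hT hpT),
        fun w hw hwv => hvT (h.injOn (hT hw) hv hwv ▸ hw)⟩

theorem hasPathCover_sdiff_pair (h : IsCorona G C R p) (hR : IsFactorCritical G R) {v : V}
    (hv : v ∈ R) : HasPathCover G (C \ {v, p v}) := by
  simpa using h.hasPathCover_sdiff (T := {v}) (by simpa using hv)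
    (by simpa [Finset.sdiff_singleton_eq_erase] using hR.2 v hv)

theorem exists_partner (h : IsCorona G C R p) (hR : IsFactorCritical G R) {z : V} (hz : z ∈ C) :
    ∃ w ∈ C, G.Adj z w ∧ HasPathCover G (C \ {z, w}) := by
  obtain ⟨v, hv, rfl | rfl⟩ := h.exists_eq_or_eq_leaf hz
  · exact ⟨p z, h.leaf_mem hv, h.adj_leaf z hv, h.hasPathCover_sdiff_pair hR hv⟩
  · exact ⟨v, h.mem_of_mem_core hv, (h.adj_leaf v hv).symm,
      Finset.pair_comm v (p v) ▸ h.hasPathCover_sdiff_pair hR hv⟩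

-- The core vertex `z` gets a path `p w, w, z, u, p u` through two of its core neighbours.
theorem hasPathCover_erase_leaf (h : IsCorona G C R p) (hR : IsFactorCritical G R) {z : V}
    (hz : z ∈ R) (hcard : 2 ≤ R.card) : HasPathCover G (C.erase (p z)) := by
  obtain ⟨v, hv, hvz⟩ := Finset.exists_mem_ne hcard z
  obtain ⟨w, hw, -, hwz, hzw, -⟩ := hR.exists_adj_hasMatching hv hz hvz.symm
  obtain ⟨u, hu, huw, huz, hzu, hmatch⟩ := hR.exists_adj_hasMatching hw hz hwz.symm
  have hrest : HasPathCover G (C \ {p w, p z, w, z, u, p u}) := by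
    simpa using h.hasPathCover_sdiff (by grind) hmatch
  have hnodup : [p w, w, z, u, p u].Nodup := by
    grind [h.ne_leaf hw hw, h.ne_leaf hz hw, h.ne_leaf hu hw, h.ne_leaf hw hu, h.ne_leaf hz hu,
      h.ne_leaf hu hu, h.leaf_ne_leaf hw hu huw.symm]
  have hchain : [p w, w, z, u, p u].IsChain G.Adj := by
    simp [(h.adj_leaf w hw).symm, hzw.symm, hzu, h.adj_leaf u hu]
  refine .of_path _ hchain hnodup (by simp) ?_ ?_
  · grind [h.ne_leaf hw hz, h.ne_leaf hz hz, h.ne_leaf hu hz, h.leaf_ne_leaf hw hz hwz,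
      h.leaf_ne_leaf hu hz huz, h.mem_of_mem_core hz, h.mem_of_mem_core hw, h.mem_of_mem_core hu,
      h.leaf_mem hw, h.leaf_mem hu]
  · convert hrest using 1
    ext a
    simp only [List.toFinset_cons, List.toFinset_nil, insert_empty_eq]
    grind

theorem hasPathCover_of_arms_leaf_core (h : IsCorona G C R p) (hR : IsFactorCritical G R)
    {z s t : V} {X Y : Finset V} (hz : z ∈ R) (hsz : G.Adj s (p z)) (htz : G.Adj t z)
    (hX : HasArm G s X) (hY : HasArm G t Y) (hsX : s ∉ X) (htY : t ∉ Y)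
    (hXY : Disjoint (insert s X) (insert t Y)) (hXC : Disjoint (insert s X) C)
    (hYC : Disjoint (insert t Y) C) : HasPathCover G (insert s X ∪ insert t Y ∪ C) := by
  simp only [Finset.disjoint_left, Finset.mem_insert, not_or] at hXY hXC hYC
  have hzC := h.mem_of_mem_core hz
  have hpzC := h.leaf_mem hz
  have harm : HasArm G s (insert (p z) (insert z (insert t Y))) :=
    ((hY.cons htz.symm htY).cons (h.adj_leaf z hz).symm (by grind)).cons hsz
      (by grind [h.ne_leaf hz hz])
  have harm' := harm.union (h.hasPathCover_sdiff_pair hR hz) (by grind [Finset.disjoint_left])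
  convert HasPathCover.of_arms hX harm' (by grind [Finset.disjoint_left]) hsX (by grind) using 1
  grind

theorem hasPathCover_of_arms_leaf (h : IsCorona G C R p)
    (hR : IsFactorCritical G R) {z x s t : V} {X Y : Finset V} (hz : z ∈ R) (hx : x ∈ C)
    (hxz : x ≠ p z) (hsz : G.Adj s (p z)) (htx : G.Adj t x)
    (hX : HasArm G s X) (hY : HasArm G t Y) (hsX : s ∉ X) (htY : t ∉ Y)
    (hXY : Disjoint (insert s X) (insert t Y)) (hXC : Disjoint (insert s X) C)
    (hYC : Disjoint (insert t Y) C) : HasPathCover G (insert s X ∪ insert t Y ∪ C) := by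
  obtain ⟨v, hv, hxv⟩ := h.exists_eq_or_eq_leaf hx
  rcases eq_or_ne v z with rfl | hvz
  · obtain rfl : x = v := hxv.resolve_right hxz
    exact h.hasPathCover_of_arms_leaf_core hR hz hsz htx hX hY hsX htY hXY hXC hYC
  simp only [Finset.disjoint_left, Finset.mem_insert, not_or] at hXY hXC hYC
  obtain ⟨w, hw, hwv, hwz, hzw, hmatch⟩ := hR.exists_adj_hasMatching hv hz hvz.symm
  have hrest : HasPathCover G (C \ {p v, p z, v, z, w, p w}) := by
    simpa using h.hasPathCover_sdiff (by grind) hmatch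
  have hnodup : [v, z, w, p v, p z, p w].Nodup := by
    grind [h.ne_leaf hv hv, h.ne_leaf hv hz, h.ne_leaf hv hw, h.ne_leaf hz hv, h.ne_leaf hz hz,
      h.ne_leaf hz hw, h.ne_leaf hw hv, h.ne_leaf hw hz, h.ne_leaf hw hw,
      h.leaf_ne_leaf hv hz hvz, h.leaf_ne_leaf hw hv hwv, h.leaf_ne_leaf hw hz hwz]
  have hmem : ∀ a ∈ [v, z, w, p v, p z, p w], a ∈ C := by
    simp [hv, hz, hw, h.mem_of_mem_core, h.leaf_mem]
  simp only [List.nodup_cons, List.mem_cons, List.not_mem_nil, not_or] at hnodup hmem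
  have harm_s : HasArm G s (insert (p z) (insert z {w, p w})) :=
    ((HasArm.pair hzw (h.adj_leaf w hw)).cons (h.adj_leaf z hz).symm (by grind)).cons hsz
      (by grind)
  have harm_t : HasArm G t {v, p v} := by
    rcases hxv with rfl | rfl
    · exact .pair htx (h.adj_leaf x hv)
    · exact Finset.pair_comm v (p v) ▸ .pair htx (h.adj_leaf v hv).symm
  have hcover_s := HasPathCover.of_arms hX harm_s (by grind [Finset.disjoint_left]) hsX (by grind)
  have hcover_t := HasPathCover.of_arms hY harm_t (by grind [Finset.disjoint_left]) htY (by grind)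
  have hdisj : Disjoint (insert s (X ∪ insert (p z) (insert z {w, p w})))
      (insert t (Y ∪ {v, p v})) := by
    simp only [Finset.disjoint_left, Finset.mem_insert, Finset.mem_union, Finset.mem_singleton]
    grind
  convert (hcover_s.union hcover_t hdisj).union hrest (by grind [Finset.disjoint_left]) using 1
  ext a
  simp only [Finset.mem_insert, Finset.mem_union, Finset.mem_singleton, Finset.mem_sdiff]
  grind

end IsCorona

theorem HasPathCover.of_arms_through {C X Y : Finset V} {s t z : V} (hz : z ∈ C)
    (hsz : G.Adj s z) (htz : G.Adj t z) (hX : HasArm G s X) (hY : HasArm G t Y) (hsX : s ∉ X)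
    (htY : t ∉ Y) (hXY : Disjoint (insert s X) (insert t Y)) (hXC : Disjoint (insert s X) C)
    (hYC : Disjoint (insert t Y) C) (hC : HasPathCover G (C.erase z)) :
    HasPathCover G (insert s X ∪ insert t Y ∪ C) := by
  simp only [Finset.disjoint_left, Finset.mem_insert, not_or] at hXY hXC hYC
  have hpath := HasPathCover.of_arms (hX.cons hsz.symm hsX) (hY.cons htz.symm htY)
    (by grind [Finset.disjoint_left]) (by grind) (by grind)
  convert hpath.union hC (by grind [Finset.disjoint_left]) using 1
  grind

namespace IsSun

variable {C : Finset V}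

theorem congr (h : IsSun G C) (hG : ∀ x ∈ C, ∀ y ∈ C, (G.Adj x y ↔ G'.Adj x y)) :
    IsSun G' C := by
  rcases h with h | ⟨R, p, h, hR⟩
  · exact .inl h
  · exact .inr ⟨R, p, h.congr hG, hR.congr fun x hx y hy =>
      (hG x (h.mem_of_mem_core hx) y (h.mem_of_mem_core hy)).1⟩

theorem exists_partner (h : IsSun G C) (hcard : 2 ≤ C.card) {z : V} (hz : z ∈ C) :
    ∃ w ∈ C, G.Adj z w ∧ HasPathCover G (C \ {z, w}) := by
  rcases h with ⟨v, rfl⟩ | ⟨R, p, h, hR⟩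
  · simp at hcard
  · exact h.exists_partner hR hz

theorem hasArm (h : IsSun G C) {s z : V} (hz : z ∈ C) (hsz : G.Adj s z) : HasArm G s C := by
  rcases h with ⟨v, rfl⟩ | ⟨R, p, h, hR⟩
  · obtain rfl : z = v := by simpa using hz
    exact .singleton hsz
  · obtain ⟨w, hw, hzw, hrest⟩ := h.exists_partner hR hz
    exact .of_sdiff_pair hsz hzw hz hw hrest

theorem hasPathCover_insert (h : IsSun G C) (hcard : 2 ≤ C.card) {s z : V} (hz : z ∈ C)
    (hsz : G.Adj s z) (hs : s ∉ C) : HasPathCover G (insert s C) := by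
  obtain ⟨w, hw, hzw, hrest⟩ := h.exists_partner hcard hz
  refine .of_path [s, z, w] (by simp [hsz, hzw]) (by grind [hzw.ne]) (by simp) (by grind) ?_
  convert hrest using 1
  grind [List.mem_toFinset]

theorem exists_leaf_notMem_pair (h : IsSun G C) (hcard : 3 ≤ C.card) (x y : V) :
    ∃ l ∈ C, ∃ m ∈ C, l ≠ x ∧ l ≠ y ∧ l ≠ m ∧ ∀ w ∈ C, G.Adj l w → w = m := by
  rcases h with ⟨v, rfl⟩ | ⟨R, p, h, hR⟩
  · simp at hcard
  have hlt : ({x, y} : Finset V).card < (R.image p).card := by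
    rw [Finset.card_image_of_injOn h.injOn]
    have := Finset.card_le_two (a := x) (b := y)
    have := h.card_eq
    obtain ⟨k, hk⟩ := hR.odd_card
    omega
  obtain ⟨l, hl, hlxy⟩ := Finset.exists_mem_notMem_of_card_lt_card hlt
  obtain ⟨v, hv, rfl⟩ := Finset.mem_image.1 hl
  simp only [Finset.mem_insert, Finset.mem_singleton, not_or] at hlxy
  exact ⟨p v, h.leaf_mem hv, v, h.mem_of_mem_core hv, hlxy.1, hlxy.2, (h.ne_leaf hv hv).symm,
    h.eq_of_leaf_adj v hv⟩

end IsSun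

end Suns

section Components

variable {V : Type*} {G G' : SimpleGraph V} {U U' C D : Finset V}

/-- No edge of `G` leads from `C` to `U \ C`. -/
def IsClosedIn (G : SimpleGraph V) (U C : Finset V) : Prop :=
  ∀ x ∈ C, ∀ y ∈ U, G.Adj x y → y ∈ C

/-- The graph induced by `G` on `C` is connected. Phrased through closed subsets, since the
arguments below compare induced graphs on varying vertex sets. -/
def IsConnectedOn (G : SimpleGraph V) (C : Finset V) : Prop :=
  C.Nonempty ∧ ∀ D ⊆ C, D.Nonempty → IsClosedIn G C D → D = C

open scoped Classical in
/-- The vertex sets of the connected components of the graph induced by `G` on `U`. -/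
noncomputable def comps (G : SimpleGraph V) (U : Finset V) : Finset (Finset V) :=
  U.powerset.filter fun C => IsConnectedOn G C ∧ IsClosedIn G U C

theorem mem_comps : C ∈ comps G U ↔ C ⊆ U ∧ IsConnectedOn G C ∧ IsClosedIn G U C := by
  simp [comps]

theorem IsClosedIn.mono (h : IsClosedIn G U C) (hU : U' ⊆ U) : IsClosedIn G U' C :=
  fun x hx y hy => h x hx y (hU hy)

theorem IsClosedIn.sdiff [DecidableEq V] (h : IsClosedIn G U C) : IsClosedIn G U (U \ C) := by
  intro x hx y hy hxy
  rw [Finset.mem_sdiff] at hx ⊢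
  exact ⟨hy, fun hyC => hx.2 (h y hyC x hx.1 hxy.symm)⟩

theorem IsClosedIn.mem_of_reachable {W : Type*} {H : SimpleGraph W} (hD : IsClosedIn G C D)
    (g : H →g G) {w u : W} (hC : ∀ v, H.Reachable w v → g v ∈ C) (hw : g w ∈ D)
    (h : H.Reachable w u) : g u ∈ D := by
  rw [SimpleGraph.reachable_iff_reflTransGen] at h
  induction h with
  | refl => exact hw
  | tail hwb hbc ih =>
    exact hD _ ih _ (hC _ ((SimpleGraph.reachable_iff_reflTransGen _ _).2 (hwb.tail hbc)))
      (g.map_adj hbc)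

namespace IsConnectedOn

theorem congr (h : IsConnectedOn G C) (hG : ∀ x ∈ C, ∀ y ∈ C, (G.Adj x y ↔ G'.Adj x y)) :
    IsConnectedOn G' C :=
  ⟨h.1, fun D hD hD0 hcl => h.2 D hD hD0 fun x hx y hy hxy =>
    hcl x hx y hy ((hG x (hD hx) y hy).1 hxy)⟩

theorem singleton (v : V) : IsConnectedOn G {v} :=
  ⟨Finset.singleton_nonempty v, fun _ hD hD0 _ => (Finset.Nonempty.subset_singleton_iff hD0).1 hD⟩

theorem subset_of_mem (h : IsConnectedOn G C) (hCU : C ⊆ U) (hD : IsClosedIn G U D) {x : V}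
    (hxC : x ∈ C) (hxD : x ∈ D) : C ⊆ D := by
  classical
  have hCD : C ∩ D = C := h.2 (C ∩ D) Finset.inter_subset_left
    ⟨x, Finset.mem_inter.2 ⟨hxC, hxD⟩⟩ fun x hx y hy hxy =>
      Finset.mem_inter.2 ⟨hy, hD x (Finset.mem_inter.1 hx).2 y (hCU hy) hxy⟩
  exact Finset.inter_eq_left.1 hCD

theorem exists_adj (h : IsConnectedOn G U) (hD : D ⊆ U) (hD0 : D.Nonempty) (hDU : D ≠ U) :
    ∃ x ∈ D, ∃ y ∈ U, y ∉ D ∧ G.Adj x y := by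
  by_contra! hcon
  exact hDU (h.2 D hD hD0 fun x hx y hy hxy => by_contra fun hyD => hcon x hx y hy hyD hxy)

end IsConnectedOn

theorem comps_eq (hC : C ∈ comps G U) (hD : D ∈ comps G U) {x : V} (hxC : x ∈ C) (hxD : x ∈ D) :
    C = D := by
  rw [mem_comps] at hC hD
  exact (hC.2.1.subset_of_mem hC.1 hD.2.2 hxC hxD).antisymm
    (hD.2.1.subset_of_mem hD.1 hC.2.2 hxD hxC)

theorem comps_disjoint (hC : C ∈ comps G U) (hD : D ∈ comps G U) (hCD : C ≠ D) : Disjoint C D :=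
  Finset.disjoint_left.2 fun _ hx hx' => hCD (comps_eq hC hD hx hx')

theorem exists_mem_comps {x : V} (hx : x ∈ U) : ∃ C ∈ comps G U, x ∈ C := by
  classical
  have hU : U ∈ U.powerset.filter fun C => x ∈ C ∧ IsClosedIn G U C := by
    simpa [hx] using show IsClosedIn G U U from fun _ _ y hy _ => hy
  obtain ⟨C, hCmin⟩ := Finset.exists_minimal ⟨U, hU⟩
  obtain ⟨hCU, hxC, hCcl⟩ := by simpa using hCmin.prop
  have eq_of_mem : ∀ D ⊆ C, x ∈ D → IsClosedIn G C D → D = C := fun D hD hxD hDcl => by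
    refine hD.antisymm (hCmin.le_of_le ?_ hD)
    simp only [Finset.mem_filter, Finset.mem_powerset]
    exact ⟨hD.trans hCU, hxD, fun a ha y hy hay => hDcl a ha y (hCcl a (hD ha) y hy hay) hay⟩
  refine ⟨C, mem_comps.2 ⟨hCU, ⟨⟨x, hxC⟩, fun D hD ⟨d, hd⟩ hDcl => ?_⟩, hCcl⟩, hxC⟩
  by_cases hxD : x ∈ D
  · exact eq_of_mem D hD hxD hDcl
  · have hsdiff : C \ D = C :=
      eq_of_mem _ Finset.sdiff_subset (Finset.mem_sdiff.2 ⟨hxC, hxD⟩) hDcl.sdiff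
    exact absurd hd (Finset.mem_sdiff.1 (hsdiff.symm ▸ hD hd)).2

theorem biUnion_comps [DecidableEq V] (G : SimpleGraph V) (U : Finset V) :
    (comps G U).biUnion id = U := by
  ext x
  simp only [Finset.mem_biUnion, id]
  exact ⟨fun ⟨C, hC, hx⟩ => (mem_comps.1 hC).1 hx, exists_mem_comps⟩

theorem sum_card_comps (G : SimpleGraph V) (U : Finset V) :
    ∑ C ∈ comps G U, C.card = U.card := by
  classical
  conv_rhs => rw [← biUnion_comps G U]
  exact (Finset.card_biUnion fun C hC D hD h => comps_disjoint hC hD h).symm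

theorem comps_transfer (h : C ∈ comps G U) (hC : C ⊆ U') (hcl : IsClosedIn G U' C) :
    C ∈ comps G U' :=
  mem_comps.2 ⟨hC, (mem_comps.1 h).2.1, hcl⟩

theorem comps_congr (h : C ∈ comps G U) (hG : ∀ x ∈ C, ∀ y ∈ U, (G.Adj x y ↔ G'.Adj x y)) :
    C ∈ comps G' U := by
  rw [mem_comps] at h ⊢
  exact ⟨h.1, h.2.1.congr fun x hx y hy => hG x hx y (h.1 hy),
    fun x hx y hy hxy => h.2.2 x hx y hy ((hG x hx y hy).2 hxy)⟩

theorem mem_comps_sdiff_of_ne [DecidableEq V] {X : Finset V} (hC : C ∈ comps G U)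
    (hD : D ∈ comps G U) (hCD : C ≠ D) (hX : X ⊆ D) : C ∈ comps G (U \ X) :=
  comps_transfer hC
    (Finset.subset_sdiff.2 ⟨(mem_comps.1 hC).1, (comps_disjoint hC hD hCD).mono_right hX⟩)
    ((mem_comps.1 hC).2.2.mono Finset.sdiff_subset)

theorem mem_comps_sdiff_of_mem_comps [DecidableEq V] {X : Finset V} (hD : D ∈ comps G U)
    (hC : C ∈ comps G (D \ X)) : C ∈ comps G (U \ X) := by
  obtain ⟨hDU, -, hDcl⟩ := mem_comps.1 hD
  obtain ⟨hCD, -, hCcl⟩ := mem_comps.1 hC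
  refine comps_transfer hC (hCD.trans (Finset.sdiff_subset_sdiff hDU subset_rfl)) ?_
  intro x hx y hy hxy
  have hyD : y ∈ D := hDcl x (Finset.mem_sdiff.1 (hCD hx)).1 y (Finset.mem_sdiff.1 hy).1 hxy
  exact hCcl x hx y (Finset.mem_sdiff.2 ⟨hyD, (Finset.mem_sdiff.1 hy).2⟩) hxy

section Embedding

variable {W : Type*} {H : SimpleGraph W} {B : Finset V}

theorem mem_comps_of_coe_eq_image_supp (g : H ↪g G) (hB : (B : Set V) = Set.range g)
    {c : H.ConnectedComponent} (hC : (C : Set V) = g '' c.supp) : C ∈ comps G B := by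
  have hmem (w : W) : g w ∈ C ↔ w ∈ c.supp := by
    rw [← Finset.mem_coe, hC, g.injective.mem_set_image]
  have hCB : C ⊆ B := Finset.coe_subset.1 (by rw [hC, hB]; exact Set.image_subset_range _ _)
  have exists_eq {x : V} (hx : x ∈ B) : ∃ w, g w = x := by
    rwa [← Finset.mem_coe, hB] at hx
  refine mem_comps.2 ⟨hCB, ⟨?_, ?_⟩, ?_⟩
  · obtain ⟨w, hw⟩ := c.nonempty_supp
    exact ⟨g w, (hmem w).2 hw⟩
  · rintro D hD ⟨x, hx⟩ hDcl
    refine hD.antisymm fun y hy => ?_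
    obtain ⟨w, rfl⟩ := exists_eq (hCB (hD hx))
    obtain ⟨u, rfl⟩ := exists_eq (hCB hy)
    have hwc := (hmem w).1 (hD hx)
    exact hDcl.mem_of_reachable g.toHom
      (fun v hwv => (hmem v).2 ((SimpleGraph.ConnectedComponent.sound hwv.symm).trans hwc)) hx
      (c.reachable_of_mem_supp hwc ((hmem u).1 hy))
  · intro x hx y hy hxy
    obtain ⟨w, rfl⟩ := exists_eq (hCB hx)
    obtain ⟨u, rfl⟩ := exists_eq hy
    exact (hmem u).2 ((c.mem_supp_congr_adj (g.map_adj_iff.1 hxy)).1 ((hmem w).1 hx))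

theorem exists_connectedComponent_equiv_comps (g : H ↪g G) (hB : (B : Set V) = Set.range g) :
    ∃ Φ : H.ConnectedComponent ≃ {C // C ∈ comps G B},
      ∀ c, ((Φ c : Finset V) : Set V) = g '' c.supp := by
  have hfin (c : H.ConnectedComponent) : (g '' c.supp).Finite :=
    B.finite_toSet.subset (hB ▸ Set.image_subset_range _ _)
  have hmem (c : H.ConnectedComponent) : (hfin c).toFinset ∈ comps G B :=
    mem_comps_of_coe_eq_image_supp g hB (hfin c).coe_toFinset
  refine ⟨.ofBijective (fun c => ⟨_, hmem c⟩) ⟨fun c d hcd => ?_, ?_⟩,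
    fun c => (hfin c).coe_toFinset⟩
  · have himage : g '' c.supp = g '' d.supp := by simpa using hcd
    exact SimpleGraph.ConnectedComponent.supp_injective (g.injective.image_injective himage)
  · rintro ⟨C, hC⟩
    obtain ⟨x, hx⟩ := (mem_comps.1 hC).2.1.1
    obtain ⟨w, rfl⟩ : x ∈ Set.range g := hB ▸ (mem_comps.1 hC).1 hx
    exact ⟨H.connectedComponentMk w, Subtype.ext (comps_eq (hmem _) hC (by simp) hx)⟩

end Embedding

variable [DecidableEq V]

open scoped Classical in
/-- The vertex sets of the components of the graph induced by `G` on `U` that are suns. -/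
noncomputable def suns (G : SimpleGraph V) (U : Finset V) : Finset (Finset V) :=
  (comps G U).filter (IsSun G)

theorem mem_suns : C ∈ suns G U ↔ C ∈ comps G U ∧ IsSun G C := by
  simp [suns]

theorem suns_subset_comps : suns G U ⊆ comps G U := by
  classical exact Finset.filter_subset _ _

theorem suns_transfer (h : C ∈ suns G U) (hC : C ⊆ U') (hcl : IsClosedIn G U' C) :
    C ∈ suns G U' :=
  mem_suns.2 ⟨comps_transfer (mem_suns.1 h).1 hC hcl, (mem_suns.1 h).2⟩

theorem suns_congr (h : C ∈ suns G U) (hG : ∀ x ∈ C, ∀ y ∈ U, (G.Adj x y ↔ G'.Adj x y)) :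
    C ∈ suns G' U := by
  rw [mem_suns] at h ⊢
  have hCU := (mem_comps.1 h.1).1
  exact ⟨comps_congr h.1 hG, h.2.congr fun x hx y hy => hG x hx y (hCU hy)⟩

theorem singleton_mem_suns {v : V} (hv : v ∈ U) (h : ∀ y ∈ U, ¬ G.Adj v y) :
    {v} ∈ suns G U := by
  refine mem_suns.2 ⟨mem_comps.2 ⟨by simpa using hv, .singleton v, ?_⟩, .inl ⟨v, rfl⟩⟩
  intro x hx y hy hxy
  obtain rfl := Finset.mem_singleton.1 hx
  exact absurd hxy (h y hy)

end Components

section Tutte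

variable {V : Type*} {G : SimpleGraph V}

open scoped Classical in
/-- The components of odd order of the graph induced by `G` on `U`. -/
noncomputable def oddComps (G : SimpleGraph V) (U : Finset V) : Finset (Finset V) :=
  (comps G U).filter fun C => Odd C.card

theorem mem_oddComps {U C : Finset V} : C ∈ oddComps G U ↔ C ∈ comps G U ∧ Odd C.card := by
  simp [oddComps]

theorem odd_card_oddComps (G : SimpleGraph V) (U : Finset V) :
    Odd (oddComps G U).card ↔ Odd U.card := by
  classical
  rw [← sum_card_comps G U, Finset.odd_sum_iff_odd_card_odd, oddComps]

theorem ncard_oddComponents_le_card_oddComps {W : Type*} {H : SimpleGraph W} {B : Finset V}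
    (g : H ↪g G) (hB : (B : Set V) = Set.range g) :
    H.oddComponents.ncard ≤ (oddComps G B).card := by
  obtain ⟨Φ, hΦ⟩ := exists_connectedComponent_equiv_comps g hB
  rw [← Set.ncard_coe_finset]
  refine Set.ncard_le_ncard_of_injOn (fun c => (Φ c : Finset V)) (fun c hc => ?_)
    (fun c _ d _ hcd => Φ.injective (Subtype.ext hcd)) (Finset.finite_toSet _)
  have hcard : (Φ c : Finset V).card = c.supp.ncard := by
    rw [← Set.ncard_coe_finset, hΦ, Set.ncard_image_of_injective _ g.injective]
  exact mem_oddComps.2 ⟨(Φ c).2, hcard ▸ hc⟩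

variable [DecidableEq V]

theorem hasMatching_of_involution (f : V → V) (A : Finset V)
    (h : ∀ x ∈ A, f x ∈ A ∧ f (f x) = x ∧ G.Adj x (f x)) : HasMatching G A := by
  induction A using Finset.strongInduction with
  | H A ih =>
    rcases A.eq_empty_or_nonempty with rfl | ⟨x, hx⟩
    · exact .empty
    obtain ⟨hfx, hffx, hadj⟩ := h x hx
    have hrest : HasMatching G (A \ {x, f x}) :=
      ih _ (by grind) fun y hy => by grind
    convert HasMatching.cons hadj (by simp) (by simp) hrest using 1
    grind

theorem hasMatching_of_isPerfectMatching {A : Finset V} {M : (G.induce (A : Set V)).Subgraph}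
    (hM : M.IsPerfectMatching) : HasMatching G A := by
  rw [SimpleGraph.Subgraph.isPerfectMatching_iff] at hM
  choose f hf hf' using hM
  refine hasMatching_of_involution (fun x => if hx : x ∈ A then (f ⟨x, hx⟩ : V) else x) A ?_
  intro x hx
  have hfx : (f ⟨x, hx⟩ : V) ∈ A := (f ⟨x, hx⟩).2
  simp only [hx, hfx, dif_pos, true_and]
  exact ⟨congrArg Subtype.val (hf' (f ⟨x, hx⟩) ⟨x, hx⟩ (hf ⟨x, hx⟩).symm).symm,
    (hf ⟨x, hx⟩).adj_sub⟩

theorem exists_lt_card_oddComps {A : Finset V} (h : ¬ HasMatching G A) :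
    ∃ T ⊆ A, T.card < (oddComps G (A \ T)).card := by
  classical
  let H := G.induce (A : Set V)
  obtain ⟨u, hu⟩ : ∃ u, H.IsTutteViolator u := by
    by_contra! hu
    exact h (hasMatching_of_isPerfectMatching (SimpleGraph.tutte.2 hu).choose_spec)
  let K := ((⊤ : H.Subgraph).deleteVerts u).coe
  let g : K ↪g G :=
    { toFun := fun w => w.1.1
      inj' := fun _ _ hab => Subtype.ext (Subtype.ext hab)
      map_rel_iff' := fun {a b} => by
        have ha := a.2
        have hb := b.2
        change G.Adj a.1.1 b.1.1 ↔ K.Adj a b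
        simp_all [K, H] }
  have hg (w) : g w = w.1.1 := rfl
  have hrange : ((A \ u.toFinset.image Subtype.val : Finset V) : Set V) = Set.range g := by
    ext x
    by_cases hx : x ∈ A <;> simp [hg, hx]
  have hcard : (u.toFinset.image Subtype.val).card = u.ncard := by
    rw [Finset.card_image_of_injective _ Subtype.val_injective, Set.ncard_eq_toFinset_card']
  exact ⟨u.toFinset.image Subtype.val, by grind,
    hcard ▸ hu.trans_le (ncard_oddComponents_le_card_oddComps g hrange)⟩

theorem card_oddComps_add_le {U Q X : Finset V} (hQ : Q ∈ oddComps G U) (hX : X ⊆ Q) :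
    (oddComps G U).card + (oddComps G (Q \ X)).card ≤ (oddComps G (U \ X)).card + 1 := by
  have hQcomp := (mem_oddComps.1 hQ).1
  have hsub : (oddComps G U).erase Q ∪ oddComps G (Q \ X) ⊆ oddComps G (U \ X) := by
    refine Finset.union_subset (fun C hC => ?_) fun C hC => ?_
    · rw [Finset.mem_erase, mem_oddComps] at hC
      exact mem_oddComps.2 ⟨mem_comps_sdiff_of_ne hC.2.1 hQcomp hC.1 hX, hC.2.2⟩
    · rw [mem_oddComps] at hC ⊢
      exact ⟨mem_comps_sdiff_of_mem_comps hQcomp hC.1, hC.2⟩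
  have hdisj : Disjoint ((oddComps G U).erase Q) (oddComps G (Q \ X)) := by
    refine Finset.disjoint_left.2 fun C hC hCQ => ?_
    rw [Finset.mem_erase, mem_oddComps] at hC
    obtain ⟨hCsub, ⟨⟨x, hx⟩, -⟩, -⟩ := mem_comps.1 (mem_oddComps.1 hCQ).1
    exact hC.1 (comps_eq hC.2.1 hQcomp hx (Finset.sdiff_subset (hCsub hx)))
  have hle := Finset.card_le_card hsub
  rw [Finset.card_union_of_disjoint hdisj, Finset.card_erase_of_mem hQ] at hle
  lia

theorem exists_add_two_le_card_oddComps {A : Finset V} (hA : Even A.card)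
    (h : ¬ HasMatching G A) : ∃ T ⊆ A, T.card + 2 ≤ (oddComps G (A \ T)).card := by
  obtain ⟨T, hTA, hlt⟩ := exists_lt_card_oddComps h
  have hparity := odd_card_oddComps G (A \ T)
  have hcard := Finset.card_sdiff_add_card_eq_card hTA
  exact ⟨T, hTA, by grind⟩

open scoped Classical in
/-- The components of the graph induced by `G` on `U` that are factor-critical. -/
noncomputable def criticalComps (G : SimpleGraph V) (U : Finset V) : Finset (Finset V) :=
  (comps G U).filter (IsFactorCritical G)

theorem mem_criticalComps {U C : Finset V} :
    C ∈ criticalComps G U ↔ C ∈ comps G U ∧ IsFactorCritical G C := by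
  simp [criticalComps]

-- For a largest Tutte violator `T`, every odd component of `R \ T` is factor-critical: otherwise
-- a violator inside that component could be added to `T`.
theorem exists_lt_card_criticalComps (G : SimpleGraph V) {R : Finset V} (hR : Odd R.card) :
    ∃ T ⊆ R, T.card < (criticalComps G (R \ T)).card := by
  classical
  have hempty : ∅ ∈ R.powerset.filter fun T => T.card < (oddComps G (R \ T)).card := by
    simpa [Finset.card_pos] using Finset.card_pos.1 ((odd_card_oddComps G R).2 hR).pos
  obtain ⟨T, hT, hmax⟩ := Finset.exists_max_image _ Finset.card ⟨∅, hempty⟩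
  simp only [Finset.mem_filter, Finset.mem_powerset] at hT hmax
  refine ⟨T, hT.1, hT.2.trans_le (Finset.card_le_card fun Q hQ => ?_)⟩
  obtain ⟨hQcomp, hQodd⟩ := mem_oddComps.1 hQ
  obtain ⟨hQsub, ⟨hQ0, -⟩, -⟩ := mem_comps.1 hQcomp
  refine mem_criticalComps.2 ⟨hQcomp, hQ0, fun v hv => by_contra fun hmatch => ?_⟩
  have heven : Even (Q.erase v).card := by
    grind [Finset.card_erase_of_mem hv]
  obtain ⟨T₁, hT₁, hle⟩ := exists_add_two_le_card_oddComps heven hmatch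
  have hX : insert v T₁ ⊆ Q := by grind
  have hdisj : Disjoint T (insert v T₁) := by grind [Finset.disjoint_left]
  have hcard : (T ∪ insert v T₁).card = T.card + T₁.card + 1 := by
    rw [Finset.card_union_of_disjoint hdisj, Finset.card_insert_of_notMem (by grind), add_assoc]
  have hadd := card_oddComps_add_le hQ hX
  rw [Finset.sdiff_insert, ← Finset.erase_sdiff_comm, sdiff_sdiff_left, Finset.sup_eq_union] at hadd
  have := hmax (T ∪ insert v T₁) ⟨by grind, by lia⟩
  lia

end Tutte

section Hall

variable {α β : Type*} [DecidableEq α] [Nonempty α]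

theorem exists_choice_card_fiber_le (𝒞 : Finset β) (N : β → Finset α) (c : α → ℕ)
    (h : ∀ 𝒟 ⊆ 𝒞, 𝒟.card ≤ ∑ s ∈ 𝒟.biUnion N, c s) :
    ∃ f : β → α, (∀ C ∈ 𝒞, f C ∈ N C) ∧ ∀ s, (𝒞.filter fun C => f C = s).card ≤ c s := by
  classical
  have hall (𝒟 : Finset {C // C ∈ 𝒞}) :
      𝒟.card ≤
        (𝒟.biUnion fun C => (N C.1).sigma fun s => (Finset.univ : Finset (Fin (c s)))).card := by
    have hunion : (𝒟.biUnion fun C => (N C.1).sigma fun s => (Finset.univ : Finset (Fin (c s)))) =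
        ((𝒟.image Subtype.val).biUnion N).sigma fun s => Finset.univ := by
      ext ⟨s, i⟩
      simp
    have hle := h (𝒟.image Subtype.val) (by grind)
    rw [Finset.card_image_of_injective _ Subtype.val_injective] at hle
    simpa [hunion] using hle
  obtain ⟨F, hFinj, hFN⟩ := (Finset.all_card_le_biUnion_card_iff_exists_injective _).1 hall
  refine ⟨fun C => if hC : C ∈ 𝒞 then (F ⟨C, hC⟩).1 else Classical.arbitrary α,
    fun C hC => ?_, fun s => ?_⟩
  · simpa [hC] using (Finset.mem_sigma.1 (hFN ⟨C, hC⟩)).1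
  · calc (𝒞.filter fun C => (if hC : C ∈ 𝒞 then (F ⟨C, hC⟩).1 else Classical.arbitrary α) = s).card
      _ ≤ ((𝒞.attach.filter fun C => (F C).1 = s).image Subtype.val).card :=
        Finset.card_le_card fun C hC => by
          obtain ⟨hC, hCs⟩ := Finset.mem_filter.1 hC
          simpa [hC] using hCs
      _ ≤ (𝒞.attach.filter fun C => (F C).1 = s).card := Finset.card_image_le
      _ ≤ (({s} : Finset α).sigma fun s => (Finset.univ : Finset (Fin (c s)))).card :=
        Finset.card_le_card_of_injOn F (fun C hC => by simpa using hC) hFinj.injOn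
      _ = c s := by simp

theorem exists_choice_card_fiber_eq (𝒞 : Finset β) (N : β → Finset α) (S : Finset α) (c : α → ℕ)
    (hN : ∀ C ∈ 𝒞, N C ⊆ S) (h : ∀ 𝒟 ⊆ 𝒞, 𝒟.card ≤ ∑ s ∈ 𝒟.biUnion N, c s)
    (hc : ∑ s ∈ S, c s = 𝒞.card) :
    ∃ f : β → α, (∀ C ∈ 𝒞, f C ∈ N C) ∧ ∀ s ∈ S, (𝒞.filter fun C => f C = s).card = c s := by
  obtain ⟨f, hf, hle⟩ := exists_choice_card_fiber_le 𝒞 N c h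
  have hsum : ∑ s ∈ S, (𝒞.filter fun C => f C = s).card = ∑ s ∈ S, c s :=
    hc ▸ (Finset.card_eq_sum_card_fiberwise fun C hC => hN C hC (hf C hC)).symm
  exact ⟨f, hf, (Finset.sum_eq_sum_iff_of_le fun s _ => hle s).1 hsum⟩

end Hall

section Barriers

variable {V : Type*} {G : SimpleGraph V} {U S C D : Finset V}

open scoped Classical in
/-- The vertices of `S` with a neighbour in `C`. -/
noncomputable def neighborsIn (G : SimpleGraph V) (S C : Finset V) : Finset V :=
  S.filter fun s => ∃ z ∈ C, G.Adj s z

theorem mem_neighborsIn {s : V} : s ∈ neighborsIn G S C ↔ s ∈ S ∧ ∃ z ∈ C, G.Adj s z := by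
  simp [neighborsIn]

theorem mem_neighborsIn_singleton {s a : V} : s ∈ neighborsIn G S {a} ↔ s ∈ S ∧ G.Adj s a := by
  simp [mem_neighborsIn]

theorem neighborsIn_subset : neighborsIn G S C ⊆ S := fun _ hx => (mem_neighborsIn.1 hx).1

variable [DecidableEq V]

/-- Kaneko's condition for the graph induced by `G` on `U`: deleting any set `S` of vertices leaves
at most `2 |S|` sun components. -/
def SunCondition (G : SimpleGraph V) (U : Finset V) : Prop :=
  ∀ S ⊆ U, (suns G (U \ S)).card ≤ 2 * S.card

/-- No nonempty set attains equality in `SunCondition`. -/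
def StrictSunCondition (G : SimpleGraph V) (U : Finset V) : Prop :=
  ∀ S ⊆ U, S.Nonempty → (suns G (U \ S)).card < 2 * S.card

/-- The vertices in the components of `U \ S` that are not suns. -/
noncomputable def nonSunPart (G : SimpleGraph V) (U S : Finset V) : Finset V :=
  (U \ S) \ (suns G (U \ S)).biUnion id

theorem biUnion_neighborsIn_subset {𝒟 : Finset (Finset V)} :
    𝒟.biUnion (neighborsIn G S) ⊆ S :=
  Finset.biUnion_subset.2 fun _ _ => neighborsIn_subset

theorem mem_nonSunPart {x : V} :
    x ∈ nonSunPart G U S ↔ (x ∈ U ∧ x ∉ S) ∧ ∀ C ∈ suns G (U \ S), x ∉ C := by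
  simp [nonSunPart]

theorem nonSunPart_subset : nonSunPart G U S ⊆ U := fun _ hx => (mem_nonSunPart.1 hx).1.1

theorem subset_of_mem_suns (hC : C ∈ suns G U) : C ⊆ U :=
  (mem_comps.1 (mem_suns.1 hC).1).1

theorem isClosedIn_of_mem_suns (hC : C ∈ suns G U) : IsClosedIn G U C :=
  (mem_comps.1 (mem_suns.1 hC).1).2.2

theorem nonempty_of_mem_suns (hC : C ∈ suns G U) : C.Nonempty :=
  (mem_comps.1 (mem_suns.1 hC).1).2.1.1

theorem isSun_of_mem_suns (hC : C ∈ suns G U) : IsSun G C := (mem_suns.1 hC).2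

theorem suns_eq (hC : C ∈ suns G U) (hD : D ∈ suns G U) {x : V} (hxC : x ∈ C) (hxD : x ∈ D) :
    C = D :=
  comps_eq (suns_subset_comps hC) (suns_subset_comps hD) hxC hxD

theorem suns_disjoint (hC : C ∈ suns G U) (hD : D ∈ suns G U) (h : C ≠ D) : Disjoint C D :=
  comps_disjoint (suns_subset_comps hC) (suns_subset_comps hD) h

theorem notMem_of_mem_suns (hC : C ∈ suns G (U \ S)) {x : V} (hx : x ∈ S) : x ∉ C :=
  fun h => (Finset.mem_sdiff.1 (subset_of_mem_suns hC h)).2 hx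

theorem isClosedIn_nonSunPart : IsClosedIn G (U \ S) (nonSunPart G U S) := by
  intro x hx y hy hxy
  rw [mem_nonSunPart] at hx ⊢
  refine ⟨by simpa using hy, fun C hC hyC => hx.2 C hC ?_⟩
  exact isClosedIn_of_mem_suns hC y hyC x (by simpa using hx.1) hxy.symm

theorem suns_subset_suns_of_isClosedIn {T : Finset V} (hD : D ⊆ U) (hcl : IsClosedIn G U D) :
    suns G (D \ T) ⊆ suns G (U \ T) := by
  intro C hC
  have hCD := subset_of_mem_suns hC
  refine suns_transfer hC (hCD.trans (Finset.sdiff_subset_sdiff hD subset_rfl)) ?_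
  intro x hx y hy hxy
  rw [Finset.mem_sdiff] at hy
  have hyD := hcl x (Finset.mem_sdiff.1 (hCD hx)).1 y hy.1 hxy
  exact isClosedIn_of_mem_suns hC x hx y (Finset.mem_sdiff.2 ⟨hyD, hy.2⟩) hxy

theorem SunCondition.of_isClosedIn (h : SunCondition G U) (hD : D ⊆ U)
    (hcl : IsClosedIn G U D) : SunCondition G D := fun T hT =>
  (Finset.card_le_card (suns_subset_suns_of_isClosedIn hD hcl)).trans (h T (hT.trans hD))

theorem StrictSunCondition.of_isClosedIn (h : StrictSunCondition G U) (hD : D ⊆ U)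
    (hcl : IsClosedIn G U D) : StrictSunCondition G D := fun T hT hT0 =>
  (Finset.card_le_card (suns_subset_suns_of_isClosedIn hD hcl)).trans_lt (h T (hT.trans hD) hT0)

theorem card_suns_nonSunPart_sdiff_add {T : Finset V} (hT : T ⊆ nonSunPart G U S) :
    (suns G (nonSunPart G U S \ T)).card + (suns G (U \ S)).card ≤
      (suns G (U \ (S ∪ T))).card := by
  have hdisj : Disjoint (suns G (nonSunPart G U S \ T)) (suns G (U \ S)) := by
    refine Finset.disjoint_left.2 fun C hC hC' => ?_
    obtain ⟨x, hx⟩ := nonempty_of_mem_suns hC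
    exact (mem_nonSunPart.1 (Finset.mem_sdiff.1 (subset_of_mem_suns hC hx)).1).2 C hC' hx
  have hsdiff : U \ (S ∪ T) = (U \ S) \ T := sdiff_sdiff_left.symm
  rw [← Finset.card_union_of_disjoint hdisj, hsdiff]
  refine Finset.card_le_card (Finset.union_subset ?_ fun C hC => ?_)
  · exact suns_subset_suns_of_isClosedIn Finset.sdiff_subset isClosedIn_nonSunPart
  · have hCT : Disjoint C T := Finset.disjoint_left.2 fun x hx hxT =>
      (mem_nonSunPart.1 (hT hxT)).2 C hC hx
    exact suns_transfer hC (Finset.subset_sdiff.2 ⟨subset_of_mem_suns hC, hCT⟩)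
      ((isClosedIn_of_mem_suns hC).mono Finset.sdiff_subset)

theorem mem_suns_sdiff_of_neighborsIn_subset {N : Finset V} (hN : N ⊆ S)
    (hC : C ∈ suns G (U \ S)) (hCN : neighborsIn G S C ⊆ N) : C ∈ suns G (U \ N) := by
  refine suns_transfer hC
    ((subset_of_mem_suns hC).trans (Finset.sdiff_subset_sdiff subset_rfl hN)) ?_
  intro x hx y hy hxy
  rw [Finset.mem_sdiff] at hy
  have hyS : y ∉ S := fun h => hy.2 (hCN (mem_neighborsIn.2 ⟨h, x, hx, hxy.symm⟩))
  exact isClosedIn_of_mem_suns hC x hx y (Finset.mem_sdiff.2 ⟨hy.1, hyS⟩) hxy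

theorem card_le_card_suns_sdiff_biUnion_neighborsIn {𝒟 : Finset (Finset V)}
    (h𝒟 : 𝒟 ⊆ suns G (U \ S)) :
    𝒟.card ≤ (suns G (U \ 𝒟.biUnion (neighborsIn G S))).card :=
  Finset.card_le_card fun _ hC => mem_suns_sdiff_of_neighborsIn_subset
    biUnion_neighborsIn_subset (h𝒟 hC) (Finset.subset_biUnion_of_mem (neighborsIn G S) hC)

section Assignments

/-- The vertex `s` of `S` together with the sun components of `U \ S` that `g` assigns to it. -/
noncomputable def assignedPart (G : SimpleGraph V) (U S : Finset V) (g : Finset V → V) (s : V) :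
    Finset V :=
  insert s (((suns G (U \ S)).filter fun C => g C = s).biUnion id)

variable {g : Finset V → V}

theorem mem_assignedPart {s x : V} :
    x ∈ assignedPart G U S g s ↔ x = s ∨ ∃ C ∈ suns G (U \ S), g C = s ∧ x ∈ C := by
  simp [assignedPart, and_assoc]

theorem assignedPart_disjoint {s t : V} (hs : s ∈ S) (ht : t ∈ S) (hst : s ≠ t) :
    Disjoint (assignedPart G U S g s) (assignedPart G U S g t) := by
  refine Finset.disjoint_left.2 fun x hxs hxt => ?_
  rw [mem_assignedPart] at hxs hxt
  obtain rfl | ⟨C, hC, rfl, hxC⟩ := hxs <;> obtain rfl | ⟨D, hD, rfl, hxD⟩ := hxt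
  · exact hst rfl
  · exact notMem_of_mem_suns hD hs hxD
  · exact notMem_of_mem_suns hC ht hxC
  · exact hst (congrArg g (suns_eq hC hD hxC hxD))

theorem nonSunPart_disjoint_assignedPart {s : V} (hs : s ∈ S) :
    Disjoint (nonSunPart G U S) (assignedPart G U S g s) := by
  refine Finset.disjoint_left.2 fun x hx hxs => ?_
  rw [mem_nonSunPart] at hx
  obtain rfl | ⟨C, hC, -, hxC⟩ := mem_assignedPart.1 hxs
  · exact hx.1.2 hs
  · exact hx.2 C hC hxC

theorem nonSunPart_union_biUnion_assignedPart (hS : S ⊆ U)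
    (hg : ∀ C ∈ suns G (U \ S), g C ∈ S) :
    nonSunPart G U S ∪ S.biUnion (assignedPart G U S g) = U := by
  ext x
  simp only [Finset.mem_union, Finset.mem_biUnion, mem_assignedPart]
  constructor
  · rintro (hx | ⟨s, hs, rfl | ⟨C, hC, -, hxC⟩⟩)
    · exact nonSunPart_subset hx
    · exact hS hs
    · exact Finset.sdiff_subset (subset_of_mem_suns hC hxC)
  · intro hx
    by_cases hxS : x ∈ S
    · exact .inr ⟨x, hxS, .inl rfl⟩
    by_cases hxC : ∃ C ∈ suns G (U \ S), x ∈ C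
    · obtain ⟨C, hC, hxC⟩ := hxC
      exact .inr ⟨g C, hg C hC, .inr ⟨C, hC, rfl, hxC⟩⟩
    · push Not at hxC
      exact .inl (mem_nonSunPart.2 ⟨⟨hx, hxS⟩, hxC⟩)

theorem hasPathCover_assignedPart {s : V} (hg : ∀ C ∈ suns G (U \ S), g C ∈ neighborsIn G S C)
    (hcard : ((suns G (U \ S)).filter fun C => g C = s).card = 2) :
    HasPathCover G (assignedPart G U S g s) := by
  obtain ⟨C, D, hCD, hfiber⟩ := Finset.card_eq_two.1 hcard
  have hmem (E : Finset V) : E ∈ suns G (U \ S) ∧ g E = s ↔ E = C ∨ E = D := by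
    simpa using Finset.ext_iff.1 hfiber E
  obtain ⟨hC, hCs⟩ := (hmem C).2 (.inl rfl)
  obtain ⟨hD, hDs⟩ := (hmem D).2 (.inr rfl)
  obtain ⟨hsS, z, hz, hsz⟩ := mem_neighborsIn.1 (hCs ▸ hg C hC)
  obtain ⟨-, w, hw, hsw⟩ := mem_neighborsIn.1 (hDs ▸ hg D hD)
  rw [assignedPart, hfiber]
  simpa using HasPathCover.of_arms ((isSun_of_mem_suns hC).hasArm hz hsz)
    ((isSun_of_mem_suns hD).hasArm hw hsw) (suns_disjoint hC hD hCD)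
    (notMem_of_mem_suns hC hsS) (notMem_of_mem_suns hD hsS)

theorem hasPathCover_of_assignment (hS : S ⊆ U)
    (hg : ∀ C ∈ suns G (U \ S), g C ∈ neighborsIn G S C) {E : Finset V} (hES : E ⊆ S)
    (hcard : ∀ s ∈ S, s ∉ E → ((suns G (U \ S)).filter fun C => g C = s).card = 2)
    (hE : HasPathCover G (nonSunPart G U S ∪ E.biUnion (assignedPart G U S g))) :
    HasPathCover G U := by
  have hrest : HasPathCover G ((S \ E).biUnion (assignedPart G U S g)) := by
    refine .biUnion _ _ (fun s hs => ?_) fun s hs t ht hst => ?_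
    · rw [Finset.mem_sdiff] at hs
      exact hasPathCover_assignedPart hg (hcard s hs.1 hs.2)
    · exact assignedPart_disjoint (Finset.sdiff_subset hs) (Finset.sdiff_subset ht) hst
  have hdisj : Disjoint (nonSunPart G U S ∪ E.biUnion (assignedPart G U S g))
      ((S \ E).biUnion (assignedPart G U S g)) := by
    simp only [Finset.disjoint_union_left, Finset.disjoint_biUnion_left,
      Finset.disjoint_biUnion_right, Finset.mem_sdiff]
    exact fun t ht => ⟨nonSunPart_disjoint_assignedPart ht.1, fun s hs =>
      assignedPart_disjoint (hES hs) ht.1 fun hst => ht.2 (hst ▸ hs)⟩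
  convert hE.union hrest hdisj using 1
  rw [Finset.union_assoc, ← Finset.union_biUnion, Finset.union_sdiff_of_subset hES,
    nonSunPart_union_biUnion_assignedPart hS fun C hC => neighborsIn_subset (hg C hC)]

theorem hasPathCover_of_card_eq_two_mul (hG : SunCondition G U) (hS : S ⊆ U)
    (hcard : (suns G (U \ S)).card = 2 * S.card) (hrest : HasPathCover G (nonSunPart G U S)) :
    HasPathCover G U := by
  cases isEmpty_or_nonempty V
  · exact Finset.eq_empty_of_isEmpty U ▸ .empty
  have hall (𝒟) (h𝒟 : 𝒟 ⊆ suns G (U \ S)) :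
      𝒟.card ≤ ∑ _s ∈ 𝒟.biUnion (neighborsIn G S), 2 := by
    have hle := card_le_card_suns_sdiff_biUnion_neighborsIn h𝒟
    have hsun := hG _ ((biUnion_neighborsIn_subset (𝒟 := 𝒟) (G := G)).trans hS)
    rw [Finset.sum_const, smul_eq_mul]
    lia
  obtain ⟨g, hg, hg2⟩ := exists_choice_card_fiber_eq _ (neighborsIn G S) S (fun _ => 2)
    (fun _ _ => neighborsIn_subset) hall (by simp [hcard, mul_comm])
  exact hasPathCover_of_assignment hS hg (Finset.empty_subset S) (fun s hs _ => hg2 s hs)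
    (by simpa using hrest)

end Assignments

section Strict

theorem card_lt_two_mul_card_biUnion_neighborsIn (hG : SunCondition G U)
    (hstrict : StrictSunCondition G U) (hS : S ⊆ U) {𝒟 : Finset (Finset V)}
    (h𝒟 : 𝒟 ⊆ suns G (U \ S)) (h0 : 𝒟.Nonempty) :
    𝒟.card < 2 * (𝒟.biUnion (neighborsIn G S)).card := by
  have hle := card_le_card_suns_sdiff_biUnion_neighborsIn h𝒟
  rcases (𝒟.biUnion (neighborsIn G S)).eq_empty_or_nonempty with hempty | hne
  · have hsun := hG ∅ (Finset.empty_subset U)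
    rw [Finset.card_empty] at hsun
    rw [hempty] at hle
    have hpos := h0.card_pos
    lia
  · exact hle.trans_lt (hstrict _ (biUnion_neighborsIn_subset.trans hS) hne)

theorem neighborsIn_nonempty (hG : SunCondition G U) (hstrict : StrictSunCondition G U)
    (hS : S ⊆ U) (hC : C ∈ suns G (U \ S)) : (neighborsIn G S C).Nonempty := by
  have hlt := card_lt_two_mul_card_biUnion_neighborsIn hG hstrict hS
    (Finset.singleton_subset_iff.2 hC) (Finset.singleton_nonempty C)
  rw [Finset.card_singleton, Finset.singleton_biUnion] at hlt
  exact Finset.card_pos.1 (by lia)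

/-- The neighbourhoods of the sun components when the component `D` is replaced by two copies:
`some D` with neighbourhood `A` and `none` with neighbourhood `B`. -/
noncomputable def splitNeighbors (G : SimpleGraph V) (S D A B : Finset V) :
    Option (Finset V) → Finset V
  | none => B
  | some C => if C = D then A else neighborsIn G S C

variable {A B : Finset V}

theorem splitNeighbors_subset (hAB : A ∪ B = neighborsIn G S D) (o : Option (Finset V)) :
    splitNeighbors G S D A B o ⊆ S := by
  have hsub : A ∪ B ⊆ S := hAB ▸ neighborsIn_subset
  rcases o with _ | C
  · exact Finset.subset_union_right.trans hsub
  · rw [splitNeighbors]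
    split_ifs
    · exact Finset.subset_union_left.trans hsub
    · exact neighborsIn_subset

theorem exists_subset_eraseNone_card_le (hAB : A ∪ B = neighborsIn G S D)
    (𝒟 : Finset (Option (Finset V))) :
    ∃ ℰ ⊆ Finset.eraseNone 𝒟, 𝒟.card ≤ ℰ.card + 1 ∧
      ℰ.biUnion (neighborsIn G S) ⊆ 𝒟.biUnion (splitNeighbors G S D A B) := by
  have hcard : 𝒟.card ≤ (Finset.eraseNone 𝒟).card + 1 := by
    rw [← Finset.card_insertNone]
    refine Finset.card_le_card fun o ho => ?_
    rcases o with _ | C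
    · simp
    · simpa using ho
  by_cases hboth : none ∈ 𝒟 ∧ some D ∈ 𝒟
  · refine ⟨_, subset_rfl, hcard, Finset.biUnion_subset.2 fun C hC x hx => ?_⟩
    rw [Finset.mem_eraseNone] at hC
    rw [Finset.mem_biUnion]
    by_cases hCD : C = D
    · obtain hxA | hxB : x ∈ A ∨ x ∈ B := by rwa [← Finset.mem_union, hAB, ← hCD]
      · exact ⟨some D, hboth.2, by simpa [splitNeighbors] using hxA⟩
      · exact ⟨none, hboth.1, hxB⟩
    · exact ⟨some C, hC, by simpa [splitNeighbors, hCD] using hx⟩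
  · refine ⟨_, Finset.erase_subset D _, ?_, Finset.biUnion_subset.2 fun C hC x hx => ?_⟩
    · by_cases hD : some D ∈ 𝒟
      · rw [Finset.card_erase_add_one (Finset.mem_eraseNone.2 hD),
          Finset.card_eraseNone_of_not_mem fun h => hboth ⟨h, hD⟩]
      · rwa [Finset.erase_eq_of_notMem (by simpa using hD)]
    · rw [Finset.mem_erase, Finset.mem_eraseNone] at hC
      exact Finset.mem_biUnion.2 ⟨some C, hC.2, by simpa [splitNeighbors, hC.1] using hx⟩

/-- `S` misses equality in `SunCondition` by one, and no nonempty set attains it. -/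
structure IsNearBarrier (G : SimpleGraph V) (U S : Finset V) : Prop where
  sunCondition : SunCondition G U
  strict : StrictSunCondition G U
  subset : S ⊆ U
  card_add_one : (suns G (U \ S)).card + 1 = 2 * S.card

namespace IsNearBarrier

theorem exists_assignment_alone (h : IsNearBarrier G U S) {s₀ : V} (hs₀ : s₀ ∈ S) :
    ∃ g : Finset V → V, (∀ C ∈ suns G (U \ S), g C ∈ neighborsIn G S C) ∧
      (∀ s ∈ S, s ≠ s₀ → ((suns G (U \ S)).filter fun C => g C = s).card = 2) ∧
      ((suns G (U \ S)).filter fun C => g C = s₀).card = 1 := by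
  have : Nonempty V := ⟨s₀⟩
  have hsum (N : Finset V) : ∑ s ∈ N, (if s = s₀ then 1 else 2) + (if s₀ ∈ N then 1 else 0) =
      2 * N.card := by
    rw [← Finset.sum_ite_eq' N s₀ fun _ => 1, ← Finset.sum_add_distrib, mul_comm, ← smul_eq_mul,
      ← Finset.sum_const]
    exact Finset.sum_congr rfl fun s _ => by split_ifs <;> rfl
  obtain ⟨g, hg, hgcard⟩ := exists_choice_card_fiber_eq (suns G (U \ S)) (neighborsIn G S) S
    (fun s => if s = s₀ then 1 else 2) (fun _ _ => neighborsIn_subset)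
    (fun 𝒟 h𝒟 => by
      rcases 𝒟.eq_empty_or_nonempty with rfl | h0
      · simp
      have hlt := card_lt_two_mul_card_biUnion_neighborsIn h.sunCondition h.strict h.subset h𝒟 h0
      grind [hsum (𝒟.biUnion (neighborsIn G S))])
    (by grind [hsum S, h.card_add_one])
  exact ⟨g, hg, fun s hs hne => by simpa [hne] using hgcard s hs, by simpa using hgcard s₀ hs₀⟩

theorem exists_mem_suns_hasPathCover_imp (h : IsNearBarrier G U S) {s₀ : V} (hs₀ : s₀ ∈ S) :
    ∃ C ∈ suns G (U \ S), s₀ ∈ neighborsIn G S C ∧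
      (HasPathCover G (nonSunPart G U S ∪ insert s₀ C) → HasPathCover G U) := by
  obtain ⟨g, hg, hg2, hg1⟩ := h.exists_assignment_alone hs₀
  obtain ⟨C, hfiber⟩ := Finset.card_eq_one.1 hg1
  obtain ⟨hC, hgC⟩ := Finset.mem_filter.1 (hfiber ▸ Finset.mem_singleton_self C)
  refine ⟨C, hC, hgC ▸ hg C hC, fun hcover => hasPathCover_of_assignment h.subset hg
    (Finset.singleton_subset_iff.2 hs₀) (fun s hs hne => hg2 s hs (by simpa using hne)) ?_⟩
  rwa [Finset.singleton_biUnion, assignedPart, hfiber, Finset.singleton_biUnion]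

theorem card_le_two_mul_card_biUnion_splitNeighbors (h : IsNearBarrier G U S)
    (hA : A.Nonempty) (hB : B.Nonempty) (hAB : A ∪ B = neighborsIn G S D)
    {𝒟 : Finset (Option (Finset V))} (h𝒟 : 𝒟 ⊆ Finset.insertNone (suns G (U \ S))) :
    𝒟.card ≤ 2 * (𝒟.biUnion (splitNeighbors G S D A B)).card := by
  obtain ⟨ℰ, hℰ, hcard, hsub⟩ := exists_subset_eraseNone_card_le hAB 𝒟
  have hle := Finset.card_le_card hsub
  rcases ℰ.eq_empty_or_nonempty with rfl | h0
  · rcases 𝒟.eq_empty_or_nonempty with rfl | ⟨o, ho⟩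
    · simp
    have hne : (splitNeighbors G S D A B o).Nonempty := by
      rcases o with _ | C
      · exact hB
      · rw [splitNeighbors]
        split_ifs
        · exact hA
        · exact neighborsIn_nonempty h.sunCondition h.strict h.subset (by simpa using h𝒟 ho)
    have hpos := (hne.mono (Finset.subset_biUnion_of_mem _ ho)).card_pos
    rw [Finset.card_empty] at hcard
    lia
  · have hℰsub : ℰ ⊆ suns G (U \ S) := fun C hC => by
      simpa using h𝒟 (Finset.mem_eraseNone.1 (hℰ hC))
    have hlt := card_lt_two_mul_card_biUnion_neighborsIn h.sunCondition h.strict h.subset hℰsub h0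
    lia

theorem exists_split_assignment (h : IsNearBarrier G U S) (hD : D ∈ suns G (U \ S))
    (hA : A.Nonempty) (hB : B.Nonempty) (hAB : A ∪ B = neighborsIn G S D)
    (hinter : ∀ s ∈ A, s ∈ B → ∃ E ∈ suns G (U \ S), E ≠ D ∧ neighborsIn G S E = {s}) :
    ∃ g : Finset V → V, (∀ C ∈ suns G (U \ S), g C ∈ neighborsIn G S C) ∧ g D ∈ A ∧
      ∃ t ∈ B, t ≠ g D ∧ ((suns G (U \ S)).filter fun C => g C = t).card = 1 ∧
        ∀ s ∈ S, s ≠ t → ((suns G (U \ S)).filter fun C => g C = s).card = 2 := by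
  have : Nonempty V := hA.to_type
  obtain ⟨f, hf, hf2⟩ := exists_choice_card_fiber_eq (Finset.insertNone (suns G (U \ S)))
    (splitNeighbors G S D A B) S (fun _ => 2) (fun o _ => splitNeighbors_subset hAB o)
    (fun 𝒟 h𝒟 => by
      simpa [mul_comm] using
        h.card_le_two_mul_card_biUnion_splitNeighbors hA hB hAB h𝒟)
    (by simp [h.card_add_one, mul_comm])
  have hgD : f (some D) ∈ A := by simpa [splitNeighbors] using hf (some D) (by simpa using hD)
  have ht : f none ∈ B := hf none (by simp)
  have hg (C) (hC : C ∈ suns G (U \ S)) : f (some C) ∈ neighborsIn G S C := by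
    by_cases hCD : C = D
    · exact hCD ▸ hAB ▸ Finset.mem_union_left _ hgD
    · simpa [splitNeighbors, hCD] using hf (some C) (by simpa using hC)
  have hfiber (s) (hs : s ∈ S) : ((suns G (U \ S)).filter fun C => f (some C) = s).card +
      (if f none = s then 1 else 0) = 2 := by
    rw [← hf2 s hs, Finset.card_filter, Finset.card_filter, Finset.sum_insertNone, add_comm]
  have hBS : B ⊆ S := splitNeighbors_subset hAB none
  refine ⟨fun C => f (some C), hg, hgD, f none, ht, fun hts => ?_, ?_, fun s hs hst => ?_⟩
  · change f none = f (some D) at hts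
    obtain ⟨E, hE, hED, hEs⟩ := hinter _ hgD (hts ▸ ht)
    have hfE : f (some E) = f (some D) := by simpa [hEs] using hg E hE
    have hsub : {D, E} ⊆ (suns G (U \ S)).filter fun C => f (some C) = f (some D) := by
      grind
    have hle := Finset.card_le_card hsub
    rw [Finset.card_pair hED.symm] at hle
    have := hfiber _ (hBS (hts ▸ ht))
    rw [if_pos hts] at this
    lia
  · simpa using hfiber _ (hBS ht)
  · simpa [hst.symm] using hfiber s hs

-- The sun `D` serves two vertices of `S` at once, which makes up for the one sun that is missing.
theorem hasPathCover_of_split (h : IsNearBarrier G U S)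
    (hrest : HasPathCover G (nonSunPart G U S)) (hD : D ∈ suns G (U \ S))
    (hA : A.Nonempty) (hB : B.Nonempty) (hAB : A ∪ B = neighborsIn G S D)
    (hinter : ∀ s ∈ A, s ∈ B → ∃ E ∈ suns G (U \ S), E ≠ D ∧ neighborsIn G S E = {s})
    (hcover : ∀ s ∈ A, ∀ t ∈ B, s ≠ t → ∀ X ∈ suns G (U \ S), ∀ Y ∈ suns G (U \ S), X ≠ Y →
      X ≠ D → Y ≠ D → s ∈ neighborsIn G S X → t ∈ neighborsIn G S Y →
      HasPathCover G (insert s X ∪ insert t Y ∪ D)) : HasPathCover G U := by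
  obtain ⟨g, hg, hgD, t, ht, htD, hgt, hg2⟩ :=
    h.exists_split_assignment hD hA hB hAB hinter
  have hABS : A ∪ B ⊆ S := hAB ▸ neighborsIn_subset
  have hsS := hABS (Finset.mem_union_left B hgD)
  have htS := hABS (Finset.mem_union_right A ht)
  obtain ⟨Y, hfiberY⟩ := Finset.card_eq_one.1 hgt
  obtain ⟨hY, rfl⟩ := Finset.mem_filter.1 (hfiberY ▸ Finset.mem_singleton_self Y)
  have hfiberD := hg2 (g D) hsS htD.symm
  obtain ⟨X, hX, hXD⟩ := Finset.exists_mem_ne (hfiberD ▸ one_lt_two) D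
  have hfiberX : ((suns G (U \ S)).filter fun C => g C = g D) = {D, X} := by
    refine (Finset.eq_of_subset_of_card_le (by grind) ?_).symm
    rw [hfiberD, Finset.card_pair hXD.symm]
  obtain ⟨hX, hgX⟩ := Finset.mem_filter.1 hX
  have hparts : ({g D, g Y} : Finset V).biUnion (assignedPart G U S g) =
      insert (g D) X ∪ insert (g Y) Y ∪ D := by
    rw [Finset.biUnion_insert, Finset.singleton_biUnion, assignedPart, assignedPart, hfiberX,
      hfiberY]
    simp only [Finset.biUnion_insert, Finset.singleton_biUnion, id]
    grind
  refine hasPathCover_of_assignment h.subset hg (E := {g D, g Y}) (by grind)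
    (fun s hs hsE => hg2 s hs (by grind)) (hrest.union ?_ ?_)
  · rw [hparts]
    exact hcover _ hgD _ ht htD.symm X hX Y hY (fun h => htD (h ▸ hgX)) hXD
      (fun h => htD (h ▸ rfl)) (hgX ▸ hg X hX) (hg Y hY)
  · rw [Finset.disjoint_biUnion_right]
    exact fun s hs => nonSunPart_disjoint_assignedPart (by grind)

end IsNearBarrier

end Strict

end Barriers

section EdgeDeletion

variable {V : Type*} {G : SimpleGraph V} {U C : Finset V} {x y : V}

theorem deleteEdges_singleton_adj {u v : V} :
    (G.deleteEdges {s(x, y)}).Adj u v ↔ G.Adj u v ∧ s(u, v) ≠ s(x, y) := by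
  rw [SimpleGraph.deleteEdges_adj, Set.mem_singleton_iff]

theorem deleteEdges_singleton_adj_iff_of_notMem (hx : x ∉ C) (hy : y ∉ C) {u : V} (hu : u ∈ C)
    (v : V) : (G.deleteEdges {s(x, y)}).Adj u v ↔ G.Adj u v := by
  rw [deleteEdges_singleton_adj]
  grind

theorem ncard_edgeSet_deleteEdges_singleton_lt [Finite V] {x y : V} (hxy : G.Adj x y) :
    (G.deleteEdges {s(x, y)}).edgeSet.ncard < G.edgeSet.ncard := by
  rw [SimpleGraph.edgeSet_deleteEdges]
  exact Set.ncard_sdiff_singleton_lt_of_mem (G.mem_edgeSet.2 hxy)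

theorem two_lt_card_of_isConnectedOn_deleteEdges
    (hU : IsConnectedOn (G.deleteEdges {s(x, y)}) U) (hx : x ∈ U) (hy : y ∈ U) (hxy : x ≠ y) :
    2 < U.card := by
  classical
  by_contra! hcard
  have hpair : {x, y} = U :=
    Finset.eq_of_subset_of_card_le (by grind) (by rwa [Finset.card_pair hxy])
  have hclosed : IsClosedIn (G.deleteEdges {s(x, y)}) U {x} := by
    intro a ha b hb hab
    rw [deleteEdges_singleton_adj] at hab
    grind
  have hsingle : {x} = U := hU.2 {x} (by simpa using hx) (Finset.singleton_nonempty x) hclosed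
  exact hxy (Finset.mem_singleton.1 (hsingle ▸ hy)).symm

variable [DecidableEq V]

theorem card_filter_mem_comps_le_one (G : SimpleGraph V) (U : Finset V) (v : V) :
    ((comps G U).filter fun C => v ∈ C).card ≤ 1 := by
  refine Finset.card_le_one.2 fun C hC D hD => ?_
  rw [Finset.mem_filter] at hC hD
  exact comps_eq hC.1 hD.1 hC.2 hD.2

theorem card_filter_mem_suns_le_one (G : SimpleGraph V) (U : Finset V) (v : V) :
    ((suns G U).filter fun C => v ∈ C).card ≤ 1 :=
  (Finset.card_le_card (Finset.filter_subset_filter _ suns_subset_comps)).trans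
    (card_filter_mem_comps_le_one G U v)

theorem card_suns_deleteEdges_le (G : SimpleGraph V) (U : Finset V) (x y : V) :
    (suns (G.deleteEdges {s(x, y)}) U).card ≤ (suns G U).card + 2 := by
  have hsub : suns (G.deleteEdges {s(x, y)}) U ⊆
      suns G U ∪ ((suns (G.deleteEdges {s(x, y)}) U).filter (fun C => x ∈ C) ∪
        (suns (G.deleteEdges {s(x, y)}) U).filter fun C => y ∈ C) := by
    intro C hC
    simp only [Finset.mem_union, Finset.mem_filter, hC, true_and]
    by_contra! hnot
    exact hnot.1 (suns_congr hC fun u hu v _ =>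
      deleteEdges_singleton_adj_iff_of_notMem hnot.2.1 hnot.2.2 hu v)
  have hcard := (Finset.card_le_card hsub).trans (Finset.card_union_le _ _)
  have hunion := Finset.card_union_le
    ((suns (G.deleteEdges {s(x, y)}) U).filter fun C => x ∈ C)
    ((suns (G.deleteEdges {s(x, y)}) U).filter fun C => y ∈ C)
  have hx := card_filter_mem_suns_le_one (G.deleteEdges {s(x, y)}) U x
  have hy := card_filter_mem_suns_le_one (G.deleteEdges {s(x, y)}) U y
  lia

theorem exists_suns_sdiff_singleton_nonempty_of_self_mem
    (hU : U ∈ suns (G.deleteEdges {s(x, y)}) U) (hx : x ∈ U) (hy : y ∈ U) (hxy : x ≠ y) :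
    ∃ m ∈ U, (suns G (U \ {m})).Nonempty := by
  have hcard := two_lt_card_of_isConnectedOn_deleteEdges
    (mem_comps.1 (suns_subset_comps hU)).2.1 hx hy hxy
  obtain ⟨l, hl, m, hm, hlx, hly, hlm, hleaf⟩ :=
    (isSun_of_mem_suns hU).exists_leaf_notMem_pair hcard x y
  refine ⟨m, hm, {l}, singleton_mem_suns (by grind) fun w hw hlw => ?_⟩
  rw [Finset.mem_sdiff, Finset.mem_singleton] at hw
  exact hw.2 (hleaf w hw.1 (deleteEdges_singleton_adj.2 ⟨hlw, by grind⟩))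

theorem exists_suns_sdiff_singleton_nonempty_of_ne (hU : IsConnectedOn G U)
    (hC : C ∈ suns (G.deleteEdges {s(x, y)}) U) (hCU : C ≠ U) :
    ∃ m ∈ U, (suns G (U \ {m})).Nonempty := by
  have hsub := subset_of_mem_suns hC
  have hcl := isClosedIn_of_mem_suns hC
  obtain ⟨a, ha, b, hb, hbC, hab⟩ := hU.exists_adj hsub (nonempty_of_mem_suns hC) hCU
  have hedge : s(a, b) = s(x, y) := by
    by_contra hne
    exact hbC (hcl a ha b hb (deleteEdges_singleton_adj.2 ⟨hab, hne⟩))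
  refine ⟨b, hb, C, suns_congr (suns_transfer hC (by grind) (hcl.mono Finset.sdiff_subset)) ?_⟩
  intro u hu v hv
  rw [deleteEdges_singleton_adj, ← hedge]
  grind

theorem SunCondition.deleteEdges (hU : IsConnectedOn G U)
    (hbarrier : ∀ S ⊆ U, S.Nonempty → (suns G (U \ S)).card + 2 ≤ 2 * S.card) (hx : x ∈ U)
    (hy : y ∈ U) (hxy : x ≠ y) : SunCondition (G.deleteEdges {s(x, y)}) U := by
  intro S hS
  rcases S.eq_empty_or_nonempty with rfl | hS0
  · rw [Finset.sdiff_empty, Finset.card_empty, mul_zero, Nat.le_zero, Finset.card_eq_zero]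
    by_contra! hne
    obtain ⟨C, hC⟩ := hne
    obtain ⟨m, hm, hsun⟩ : ∃ m ∈ U, (suns G (U \ {m})).Nonempty := by
      by_cases hCU : C = U
      · exact exists_suns_sdiff_singleton_nonempty_of_self_mem (hCU ▸ hC) hx hy hxy
      · exact exists_suns_sdiff_singleton_nonempty_of_ne hU hC hCU
    have hle := hbarrier {m} (by simpa using hm) (Finset.singleton_nonempty m)
    have hpos := hsun.card_pos
    rw [Finset.card_singleton] at hle
    lia
  · exact (card_suns_deleteEdges_le G (U \ S) x y).trans (hbarrier S hS hS0)

end EdgeDeletion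

section Pendant

variable {V : Type*} {G G' : SimpleGraph V} {U K T : Finset V} {a s z : V}

theorem exists_isChain_cons_of_leaf [DecidableEq V] (hle : G' ≤ G) {l : List V}
    (hchain : l.IsChain G'.Adj) (hnodup : l.Nodup) (hs : s ∈ l)
    (hleaf : ∀ v w, G'.Adj s v → G'.Adj s w → v = w) (ha : a ∉ l) (has : G.Adj a s) :
    ∃ m : List V, m.IsChain G.Adj ∧ m.Nodup ∧ m.length = l.length + 1 ∧
      m.toFinset = insert a l.toFinset := by
  have hchainG : l.IsChain G.Adj := hchain.imp fun _ _ h => hle h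
  obtain ⟨p, q, rfl⟩ := List.append_of_mem hs
  rcases List.eq_nil_or_concat' p with rfl | ⟨p, u, rfl⟩
  · exact ⟨a :: s :: q, by simpa [has] using hchainG, List.nodup_cons.2 ⟨ha, hnodup⟩, rfl, by simp⟩
  rcases q with _ | ⟨w, q⟩
  · refine ⟨(p ++ [u]) ++ [s] ++ [a], ?_, ?_, by simp, by ext; simp; tauto⟩
    · exact List.isChain_append.2 ⟨hchainG, by simp, by simp [has.symm]⟩
    · exact hnodup.append (List.nodup_singleton a) (by simpa using ha)
  · rw [List.append_assoc, List.singleton_append, List.isChain_append_cons_cons] at hchain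
    have huw := hleaf u w hchain.2.1.symm (List.isChain_cons_cons.1 hchain.2.2).1
    grind

theorem HasPathCover.insert_of_leaf [DecidableEq V] (hle : G' ≤ G) (h : HasPathCover G' U)
    (hs : s ∈ U) (hleaf : ∀ v w, G'.Adj s v → G'.Adj s w → v = w) (ha : a ∉ U)
    (has : G.Adj a s) : HasPathCover G (insert a U) := by
  induction h with
  | empty => exact absurd hs (Finset.notMem_empty s)
  | @cons U l hchain hnodup hlen hdisj hU ih =>
    rw [Finset.mem_union, List.mem_toFinset, not_or] at ha
    by_cases hsl : s ∈ l
    · obtain ⟨m, hmchain, hmnodup, hmlen, hm⟩ :=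
        exists_isChain_cons_of_leaf hle hchain hnodup hsl hleaf ha.1 has
      rw [← Finset.insert_union, ← hm]
      exact .cons m hmchain hmnodup (by lia)
        (hm ▸ Finset.disjoint_insert_left.2 ⟨ha.2, hdisj⟩) (hU.mono hle)
    · rw [← Finset.union_insert]
      exact .cons l (hchain.imp fun _ _ h => hle h) hnodup hlen
        (Finset.disjoint_insert_right.2 ⟨by simpa using ha.1, hdisj⟩)
        (ih (by simpa [hsl] using hs) ha.2)

/-- The subgraph of `G` in which all edges at `s` other than `s z` are deleted. -/
def pendantAt (G : SimpleGraph V) (s z : V) : SimpleGraph V where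
  Adj u v := G.Adj u v ∧ (u = s → v = z) ∧ (v = s → u = z)
  symm := ⟨fun _ _ h => ⟨h.1.symm, h.2.2, h.2.1⟩⟩
  loopless := ⟨fun _ h => h.1.ne rfl⟩

theorem pendantAt_le : pendantAt G s z ≤ G := fun _ _ h => h.1

theorem pendantAt_adj_iff_of_ne {u v : V} (hu : u ≠ s) (hv : v ≠ s) :
    (pendantAt G s z).Adj u v ↔ G.Adj u v := by
  simp [pendantAt, hu, hv]

theorem pendantAt_adj_self (hsz : G.Adj s z) : (pendantAt G s z).Adj s z :=
  ⟨hsz, fun _ => rfl, fun hzs => absurd hzs hsz.ne.symm⟩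

variable [DecidableEq V]

theorem suns_pendantAt_subset (hs : s ∉ U) : suns (pendantAt G s z) U ⊆ suns G U :=
  fun _ hC => suns_congr hC fun _ hu _ hv => pendantAt_adj_iff_of_ne
    (ne_of_mem_of_not_mem (subset_of_mem_suns hC hu) hs) (ne_of_mem_of_not_mem hv hs)

theorem card_suns_pendantAt_insert_le :
    (suns (pendantAt G s z) (insert s U)).card ≤ (suns G (U.erase s)).card + 1 := by
  have hsub : suns (pendantAt G s z) (insert s U) ⊆
      suns G (U.erase s) ∪ (suns (pendantAt G s z) (insert s U)).filter fun C => s ∈ C := by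
    intro C hC
    rw [Finset.mem_union, Finset.mem_filter]
    by_cases hsC : s ∈ C
    · exact .inr ⟨hC, hsC⟩
    · have hCU := subset_of_mem_suns hC
      refine .inl (suns_pendantAt_subset (Finset.notMem_erase s U) (suns_transfer hC (by grind) ?_))
      exact (isClosedIn_of_mem_suns hC).mono (by grind)
  have hcard := (Finset.card_le_card hsub).trans (Finset.card_union_le _ _)
  have hone := card_filter_mem_suns_le_one (pendantAt G s z) (insert s U) s
  lia

theorem isConnectedOn_insert (hK : IsConnectedOn G K) (hz : z ∈ K) (hsz : G.Adj s z) :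
    IsConnectedOn G (insert s K) := by
  refine ⟨Finset.insert_nonempty s K, fun D hD ⟨u, hu⟩ hcl => hD.antisymm ?_⟩
  obtain ⟨v, hvK, hvD⟩ : ∃ v ∈ K, v ∈ D := by
    rcases Finset.mem_insert.1 (hD hu) with rfl | huK
    · exact ⟨z, hz, hcl u hu z (Finset.mem_insert_of_mem hz) hsz⟩
    · exact ⟨u, huK, hu⟩
  have hKD : K ⊆ D := hK.subset_of_mem (Finset.subset_insert s K) hcl hvK hvD
  exact Finset.insert_subset (hcl z (hKD hz) s (Finset.mem_insert_self s K) hsz.symm) hKD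

theorem suns_eq_empty_of_isConnectedOn (hU : IsConnectedOn G U) (hsun : ¬ IsSun G U) :
    suns G U = ∅ := by
  refine Finset.eq_empty_of_forall_notMem fun C hC => hsun ?_
  rw [← hU.2 C (subset_of_mem_suns hC) (nonempty_of_mem_suns hC) (isClosedIn_of_mem_suns hC)]
  exact isSun_of_mem_suns hC

theorem StrictSunCondition.sunCondition (h : StrictSunCondition G K) (hK : IsConnectedOn G K)
    (hsun : ¬ IsSun G K) : SunCondition G K := by
  intro T hT
  rcases T.eq_empty_or_nonempty with rfl | hT0
  · simp [suns_eq_empty_of_isConnectedOn hK hsun]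
  · exact (h T hT hT0).le

theorem StrictSunCondition.pendantAt_insert (h : StrictSunCondition G K) (hK : IsConnectedOn G K)
    (hsun : ¬ IsSun G K) (hz : z ∈ K) (hs : s ∉ K) (hsz : G.Adj s z)
    (hsun' : ¬ IsSun (pendantAt G s z) (insert s K)) :
    SunCondition (pendantAt G s z) (insert s K) := by
  intro T hT
  by_cases hsT : s ∈ T
  · have hTK : T.erase s ⊆ K := by grind
    have hsdiff : insert s K \ T = K \ T.erase s := by grind
    rw [hsdiff]
    calc (suns (pendantAt G s z) (K \ T.erase s)).card
        ≤ (suns G (K \ T.erase s)).card :=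
          Finset.card_le_card (suns_pendantAt_subset (by grind))
      _ ≤ 2 * (T.erase s).card := h.sunCondition hK hsun _ hTK
      _ ≤ 2 * T.card := Nat.mul_le_mul_left 2 (Finset.card_erase_le)
  · rcases T.eq_empty_or_nonempty with rfl | hT0
    · have hK' : IsConnectedOn (pendantAt G s z) K := hK.congr fun u hu v hv =>
        (pendantAt_adj_iff_of_ne (ne_of_mem_of_not_mem hu hs) (ne_of_mem_of_not_mem hv hs)).symm
      simp [suns_eq_empty_of_isConnectedOn
        (isConnectedOn_insert hK' hz (pendantAt_adj_self hsz)) hsun']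
    · have hlt := h T (by grind) hT0
      have hle := card_suns_pendantAt_insert_le (G := G) (s := s) (z := z) (U := K \ T)
      rw [Finset.erase_eq_of_notMem (by grind), ← Finset.insert_sdiff_of_notMem K hsT] at hle
      lia

theorem hasPathCover_insert_insert (hK : IsConnectedOn G K) (hsun : ¬ IsSun G K)
    (hstrict : StrictSunCondition G K) (hz : z ∈ K) (hs : s ∉ K) (ha : a ∉ K)
    (has : G.Adj a s) (hsz : G.Adj s z)
    (ih : ∀ G' ≤ G, SunCondition G' (insert s K) → HasPathCover G' (insert s K)) :
    HasPathCover G (insert a (insert s K)) := by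
  by_cases hsun' : IsSun (pendantAt G s z) (insert s K)
  · have hcard : 2 ≤ (insert s K).card := by
      rw [Finset.card_insert_of_notMem hs]
      exact Nat.succ_le_succ (Finset.card_pos.2 ⟨z, hz⟩)
    obtain ⟨w, -, hsw, hrest⟩ := hsun'.exists_partner hcard (Finset.mem_insert_self s K)
    obtain rfl : w = z := hsw.2.1 rfl
    refine .of_path [a, s, w] (by simp [has, hsz]) (by grind [has.ne, hsz.ne]) (by simp)
      (by grind) ?_
    convert hrest.mono pendantAt_le using 1
    grind [List.mem_toFinset, has.ne]
  · refine (ih _ pendantAt_le (hstrict.pendantAt_insert hK hsun hz hs hsz hsun')).insert_of_leaf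
      pendantAt_le (Finset.mem_insert_self s K) (fun v w hv hw => ?_) (by grind [has.ne]) has
    rw [hv.2.1 rfl, hw.2.1 rfl]

end Pendant

section OddCoronas

variable {V : Type*} [DecidableEq V] {G : SimpleGraph V} {U C D R R' Q T : Finset V} {p p' : V → V}

theorem IsConnectedOn.union_image (hQ : IsConnectedOn G Q) (hp : ∀ v ∈ Q, G.Adj v (p v)) :
    IsConnectedOn G (Q ∪ Q.image p) := by
  refine ⟨hQ.1.mono Finset.subset_union_left, fun D hD hD0 hcl => ?_⟩
  obtain ⟨q, hq, hqD⟩ : ∃ q ∈ Q, q ∈ D := by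
    obtain ⟨x, hx⟩ := hD0
    rcases Finset.mem_union.1 (hD hx) with h | h
    · exact ⟨x, h, hx⟩
    · obtain ⟨q, hq, rfl⟩ := Finset.mem_image.1 h
      exact ⟨q, hq, hcl _ hx q (Finset.mem_union_left _ hq) (hp q hq).symm⟩
  have hQD : Q ⊆ D := hQ.subset_of_mem Finset.subset_union_left hcl hq hqD
  refine hD.antisymm (Finset.union_subset hQD ?_)
  exact Finset.image_subset_iff.2 fun v hv =>
    hcl v (hQD hv) _ (Finset.mem_union_right _ (Finset.mem_image_of_mem p hv)) (hp v hv)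

namespace IsCorona

theorem restrict (h : IsCorona G C R p) (hQ : Q ⊆ R) : IsCorona G (Q ∪ Q.image p) Q p where
  eq_union := rfl
  leaf_notMem v hv hpv := h.leaf_notMem v (hQ hv) (hQ hpv)
  injOn := h.injOn.mono hQ
  adj_leaf v hv := h.adj_leaf v (hQ hv)
  eq_of_leaf_adj v hv y hy := h.eq_of_leaf_adj v (hQ hv) y <| by
    rw [h.eq_union]
    exact Finset.union_subset_union hQ (Finset.image_subset_image hQ) hy

theorem singleton_leaf_mem_suns (h : IsCorona G C R p) (hT : T ⊆ R) {t : V} (ht : t ∈ T) :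
    {p t} ∈ suns G (C \ T) := by
  refine singleton_mem_suns ?_ fun y hy hpy => ?_
  · exact Finset.mem_sdiff.2 ⟨h.leaf_mem (hT ht), fun hp => h.leaf_notMem t (hT ht) (hT hp)⟩
  · obtain ⟨hyC, hyT⟩ := Finset.mem_sdiff.1 hy
    exact hyT (h.eq_of_leaf_adj t (hT ht) y hyC hpy ▸ ht)

theorem union_image_mem_suns (h : IsCorona G C R p) (hT : T ⊆ R)
    (hQ : Q ∈ criticalComps G (R \ T)) : Q ∪ Q.image p ∈ suns G (C \ T) := by
  obtain ⟨hQcomp, hQcrit⟩ := mem_criticalComps.1 hQ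
  obtain ⟨hQsub, hQconn, hQclosed⟩ := mem_comps.1 hQcomp
  have hQR : Q ⊆ R := hQsub.trans Finset.sdiff_subset
  refine mem_suns.2 ⟨mem_comps.2 ⟨?_, hQconn.union_image fun v hv => h.adj_leaf v (hQR hv), ?_⟩,
    Or.inr ⟨Q, p, h.restrict hQR, hQcrit⟩⟩
  · have := h.leaf_notMem
    grind [h.eq_union]
  · intro x hx y hy hxy
    obtain ⟨hyC, hyT⟩ := Finset.mem_sdiff.1 hy
    rcases Finset.mem_union.1 hx with hx | hx
    · obtain ⟨w, hw, rfl | rfl⟩ := h.exists_eq_or_eq_leaf hyC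
      · exact Finset.mem_union_left _ (hQclosed x hx y (Finset.mem_sdiff.2 ⟨hw, hyT⟩) hxy)
      · obtain rfl := h.eq_of_leaf_adj w hw x (h.mem_of_mem_core (hQR hx)) hxy.symm
        exact Finset.mem_union_right _ (Finset.mem_image_of_mem p hx)
    · obtain ⟨q, hq, rfl⟩ := Finset.mem_image.1 hx
      exact h.eq_of_leaf_adj q (hQR hq) y hyC hxy ▸ Finset.mem_union_left _ hq

theorem union_image_inter (h : IsCorona G C R p) (hQ : Q ⊆ R) : (Q ∪ Q.image p) ∩ R = Q := by
  have := h.leaf_notMem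
  grind

theorem card_add_card_criticalComps_le (h : IsCorona G C R p) (hT : T ⊆ R) :
    T.card + (criticalComps G (R \ T)).card ≤ (suns G (C \ T)).card := by
  have hsub : ∀ Q ∈ criticalComps G (R \ T), Q ⊆ R := fun Q hQ =>
    (mem_comps.1 (mem_criticalComps.1 hQ).1).1.trans Finset.sdiff_subset
  have hinjT : Set.InjOn (fun t => ({p t} : Finset V)) T := fun t ht t' ht' heq =>
    h.injOn (hT ht) (hT ht') (Finset.singleton_injective heq)
  have hinjQ : Set.InjOn (fun Q : Finset V => Q ∪ Q.image p) (criticalComps G (R \ T)) :=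
    fun Q hQ Q' hQ' (heq : Q ∪ Q.image p = Q' ∪ Q'.image p) => by
      rw [← h.union_image_inter (hsub Q hQ), heq, h.union_image_inter (hsub Q' hQ')]
  rw [← Finset.card_image_of_injOn hinjT, ← Finset.card_image_of_injOn hinjQ,
    ← Finset.card_union_of_disjoint]
  · exact Finset.card_le_card <| Finset.union_subset
      (Finset.image_subset_iff.2 fun t ht => h.singleton_leaf_mem_suns hT ht)
      (Finset.image_subset_iff.2 fun Q hQ => h.union_image_mem_suns hT hQ)
  · refine Finset.disjoint_left.2 fun E hE hE' => ?_
    obtain ⟨t, ht, rfl⟩ := Finset.mem_image.1 hE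
    obtain ⟨Q, hQ, heq⟩ := Finset.mem_image.1 hE'
    obtain ⟨q, hq⟩ := (mem_comps.1 (mem_criticalComps.1 hQ).1).2.1.1
    obtain rfl : q = p t := by
      rw [← Finset.mem_singleton, ← heq]
      exact Finset.mem_union_left _ hq
    exact h.leaf_notMem t (hT ht) (hsub Q hQ hq)

theorem not_sunCondition (h : IsCorona G C R p) (hodd : Odd R.card) : ¬ SunCondition G C := by
  intro hC
  obtain ⟨T, hT, hlt⟩ := exists_lt_card_criticalComps G hodd
  have hle := h.card_add_card_criticalComps_le hT
  have := hC T (hT.trans fun v => h.mem_of_mem_core)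
  lia

end IsCorona

/-- A corona on `C ⊆ U` whose pendant vertices are pendant in the graph induced on all of `U`. -/
structure IsPendantCorona (G : SimpleGraph V) (U C R : Finset V) (p : V → V) : Prop extends
    IsCorona G C R p where
  subset : C ⊆ U
  pendant : ∀ v ∈ R, ∀ y ∈ U, G.Adj (p v) y → y = v

theorem IsPendantCorona.union (h : IsPendantCorona G U C R p) (h' : IsPendantCorona G U D R' p')
    (hdisj : Disjoint C D) :
    IsPendantCorona G U (C ∪ D) (R ∪ R') (R.piecewise p p') := by
  have hR : ∀ v ∈ R, R.piecewise p p' v = p v := fun v hv => R.piecewise_eq_of_mem p p' hv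
  have hR' : ∀ v ∈ R', R.piecewise p p' v = p' v := fun v hv =>
    R.piecewise_eq_of_notMem p p' fun hvR =>
      Finset.disjoint_left.1 hdisj (h.mem_of_mem_core hvR) (h'.mem_of_mem_core hv)
  have hpendant : ∀ v ∈ R ∪ R', ∀ y ∈ U, G.Adj (R.piecewise p p' v) y → y = v := by
    intro v hv
    rcases Finset.mem_union.1 hv with hv | hv
    · exact hR v hv ▸ h.pendant v hv
    · exact hR' v hv ▸ h'.pendant v hv
  have hadj : ∀ v ∈ R ∪ R', G.Adj v (R.piecewise p p' v) := by
    intro v hv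
    rcases Finset.mem_union.1 hv with hv | hv
    · exact hR v hv ▸ h.adj_leaf v hv
    · exact hR' v hv ▸ h'.adj_leaf v hv
  have hsubset : C ∪ D ⊆ U := Finset.union_subset h.subset h'.subset
  have hcore : R ∪ R' ⊆ C ∪ D := Finset.union_subset_union (fun _ => h.mem_of_mem_core)
    fun _ => h'.mem_of_mem_core
  refine ⟨⟨?_, ?_, ?_, hadj, fun v hv y hy => hpendant v hv y (hsubset hy)⟩, hsubset, hpendant⟩
  · rw [Finset.image_union, Finset.image_congr hR, Finset.image_congr hR',
      Finset.union_union_union_comm, ← h.eq_union, ← h'.eq_union]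
  · intro v hv
    rcases Finset.mem_union.1 hv with hv | hv
    · exact hR v hv ▸ Finset.notMem_union.2 ⟨h.leaf_notMem v hv, fun hpv =>
        Finset.disjoint_left.1 hdisj (h.leaf_mem hv) (h'.mem_of_mem_core hpv)⟩
    · exact hR' v hv ▸ Finset.notMem_union.2 ⟨fun hpv =>
        Finset.disjoint_left.1 hdisj (h.mem_of_mem_core hpv) (h'.leaf_mem hv),
        h'.leaf_notMem v hv⟩
  · intro v hv w hw hvw
    exact hpendant w hw v (hsubset (hcore hv)) (hvw ▸ (hadj v hv).symm)

theorem exists_isPendantCorona_biUnion {ι : Type*} (s : Finset ι) (f : ι → Finset V)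
    (hdisj : (s : Set ι).PairwiseDisjoint f)
    (h : ∀ i ∈ s, ∃ R p, IsPendantCorona G U (f i) R p ∧ Odd R.card) :
    ∃ R p, IsPendantCorona G U (s.biUnion f) R p ∧ (Odd R.card ↔ Odd s.card) := by
  classical
  induction s using Finset.induction_on with
  | empty =>
    exact ⟨∅, id, ⟨⟨by simp, by simp, by simp, by simp, by simp⟩, by simp, by simp⟩, by simp⟩
  | insert i s his ih =>
    obtain ⟨R, p, hRp, hodd⟩ := h i (Finset.mem_insert_self i s)
    obtain ⟨R', p', hRp', hiff⟩ := ih (hdisj.subset (by simp))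
      fun j hj => h j (Finset.mem_insert_of_mem hj)
    have hfi : Disjoint (f i) (s.biUnion f) := (Finset.disjoint_biUnion_right _ _ _).2 fun j hj =>
      hdisj (by simp) (by simp [hj]) (ne_of_mem_of_not_mem hj his).symm
    have hRR' : Disjoint R R' :=
      hfi.mono (fun _ => hRp.mem_of_mem_core) fun _ => hRp'.mem_of_mem_core
    rw [Finset.biUnion_insert]
    refine ⟨R ∪ R', R.piecewise p p', hRp.union hRp' hfi, ?_⟩
    rw [Finset.card_union_of_disjoint hRR', Finset.card_insert_of_notMem his, Nat.odd_add_one,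
      ← hiff, Nat.odd_add, iff_true_left hodd, Nat.not_odd_iff_even]

end OddCoronas

section NearBarriers

variable {V : Type*} [DecidableEq V] {G : SimpleGraph V} {U S C D R X Y : Finset V} {p : V → V}

theorem disjoint_insert_insert_of_mem_suns (hX : X ∈ suns G (U \ S)) (hY : Y ∈ suns G (U \ S))
    (hXY : X ≠ Y) {s t : V} (hs : s ∈ S) (ht : t ∈ S) (hst : s ≠ t) :
    Disjoint (insert s X) (insert t Y) := by
  have := notMem_of_mem_suns hX ht
  have := notMem_of_mem_suns hY hs
  have := suns_disjoint hX hY hXY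
  grind [Finset.disjoint_left]

theorem disjoint_insert_of_mem_suns (hX : X ∈ suns G (U \ S)) (hD : D ∈ suns G (U \ S))
    (hXD : X ≠ D) {s : V} (hs : s ∈ S) : Disjoint (insert s X) D :=
  Finset.disjoint_insert_left.2 ⟨notMem_of_mem_suns hD hs, suns_disjoint hX hD hXD⟩

theorem hasArm_of_mem_neighborsIn (hX : X ∈ suns G (U \ S)) {s : V}
    (hs : s ∈ neighborsIn G S X) : HasArm G s X := by
  obtain ⟨-, z, hz, hsz⟩ := mem_neighborsIn.1 hs
  exact (isSun_of_mem_suns hX).hasArm hz hsz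

theorem neighborsIn_singleton_union_erase {z : V} (hz : z ∈ D) :
    neighborsIn G S {z} ∪ neighborsIn G S (D.erase z) = neighborsIn G S D := by
  ext s
  simp only [Finset.mem_union, mem_neighborsIn]
  grind

theorem IsCorona.swap_of_singleton {v : V} (h : IsCorona G D {v} p) :
    IsCorona G D {p v} fun _ => v := by
  have hD : D = {p v, v} := by
    rw [h.eq_union, Finset.image_singleton, Finset.pair_comm]
    rfl
  have hadj := h.adj_leaf v (Finset.mem_singleton_self v)
  subst hD
  refine ⟨by simp, by simpa using hadj.ne, by simp, by simpa using hadj.symm, ?_⟩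
  simp

/-- `C` together with its neighbours in `S` when `C` is a single vertex, and `C` itself otherwise.
For a near barrier `S` of a set without path cover these sets are coronas that partition it. -/
noncomputable def extendedSun (G : SimpleGraph V) (S C : Finset V) : Finset V :=
  if C.card = 1 then C ∪ neighborsIn G S C else C

theorem mem_extendedSun {x : V} :
    x ∈ extendedSun G S C ↔ x ∈ C ∨ C.card = 1 ∧ x ∈ neighborsIn G S C := by
  rw [extendedSun]
  split_ifs with hC <;> simp [hC]

namespace IsNearBarrier

theorem hasPathCover_of_hub (h : IsNearBarrier G U S) (hrest : HasPathCover G (nonSunPart G U S))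
    (hD : D ∈ suns G (U \ S)) {z : V} (hz : z ∈ D) (herase : HasPathCover G (D.erase z))
    {A B : Finset V} (hA : A.Nonempty) (hB : B.Nonempty) (hAz : A ⊆ neighborsIn G S {z})
    (hBz : B ⊆ neighborsIn G S {z}) (hAB : A ∪ B = neighborsIn G S D)
    (hinter : ∀ s ∈ A, s ∈ B → ∃ E ∈ suns G (U \ S), E ≠ D ∧ neighborsIn G S E = {s}) :
    HasPathCover G U := by
  refine h.hasPathCover_of_split hrest hD hA hB hAB hinter ?_
  intro s hs t ht hst X hX Y hY hXY hXD hYD hsX htY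
  obtain ⟨hsS, hsz⟩ := mem_neighborsIn_singleton.1 (hAz hs)
  obtain ⟨htS, htz⟩ := mem_neighborsIn_singleton.1 (hBz ht)
  exact .of_arms_through hz hsz htz (hasArm_of_mem_neighborsIn hX hsX)
    (hasArm_of_mem_neighborsIn hY htY) (notMem_of_mem_suns hX hsS) (notMem_of_mem_suns hY htS)
    (disjoint_insert_insert_of_mem_suns hX hY hXY hsS htS hst)
    (disjoint_insert_of_mem_suns hX hD hXD hsS) (disjoint_insert_of_mem_suns hY hD hYD htS) herase

theorem neighborsIn_singleton_eq (h : IsNearBarrier G U S)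
    (hrest : HasPathCover G (nonSunPart G U S)) (hno : ¬ HasPathCover G U) {a s : V}
    (ha : {a} ∈ suns G (U \ S)) (hs : s ∈ neighborsIn G S {a}) : neighborsIn G S {a} = {s} := by
  by_contra hne
  have hB : ((neighborsIn G S {a}).erase s).Nonempty :=
    (Finset.erase_nonempty hs).2 ((Finset.nontrivial_iff_ne_singleton hs).2 hne)
  refine hno (h.hasPathCover_of_hub hrest ha (Finset.mem_singleton_self a)
    (by simpa using HasPathCover.empty) (Finset.singleton_nonempty s) hB
    (Finset.singleton_subset_iff.2 hs) (Finset.erase_subset _ _) ?_ ?_)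
  · rw [← Finset.insert_eq, Finset.insert_erase hs]
  · exact fun t ht ht' => absurd (Finset.mem_singleton.1 ht) (Finset.ne_of_mem_erase ht')

theorem exists_singleton_mem_suns (h : IsNearBarrier G U S) (hrest : nonSunPart G U S = ∅)
    (hno : ¬ HasPathCover G U) {s : V} (hs : s ∈ S) :
    ∃ a, {a} ∈ suns G (U \ S) ∧ neighborsIn G S {a} = {s} := by
  obtain ⟨C, hC, hsC, himp⟩ := h.exists_mem_suns_hasPathCover_imp hs
  have hcard : C.card = 1 := by
    refine le_antisymm ?_ (nonempty_of_mem_suns hC).card_pos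
    by_contra! hcard
    obtain ⟨-, z, hz, hsz⟩ := mem_neighborsIn.1 hsC
    refine hno (himp ?_)
    rw [hrest, Finset.empty_union]
    exact (isSun_of_mem_suns hC).hasPathCover_insert hcard hz hsz (notMem_of_mem_suns hC hs)
  obtain ⟨a, rfl⟩ := Finset.card_eq_one.1 hcard
  exact ⟨a, hC, h.neighborsIn_singleton_eq (hrest ▸ .empty) hno hC hsC⟩

theorem eq_of_neighborsIn_eq_singleton (h : IsNearBarrier G U S) {s : V} (hs : s ∈ S)
    (hC : C ∈ suns G (U \ S)) (hD : D ∈ suns G (U \ S)) (hCs : neighborsIn G S C = {s})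
    (hDs : neighborsIn G S D = {s}) : C = D := by
  by_contra hCD
  have hsS := Finset.singleton_subset_iff.2 hs
  have hsub : {C, D} ⊆ suns G (U \ {s}) := Finset.insert_subset_iff.2
    ⟨mem_suns_sdiff_of_neighborsIn_subset hsS hC hCs.le,
      Finset.singleton_subset_iff.2 (mem_suns_sdiff_of_neighborsIn_subset hsS hD hDs.le)⟩
  have hle := Finset.card_le_card hsub
  have hlt := h.strict {s} (hsS.trans h.subset) (Finset.singleton_nonempty s)
  rw [Finset.card_pair hCD] at hle
  rw [Finset.card_singleton] at hlt
  lia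

theorem hasPathCover_of_leaf_attached (h : IsNearBarrier G U S)
    (hrest : HasPathCover G (nonSunPart G U S))
    (hprivate : ∀ s ∈ S, ∃ E ∈ suns G (U \ S), E ≠ D ∧ neighborsIn G S E = {s})
    (hD : D ∈ suns G (U \ S)) (hDR : IsCorona G D R p) (hR : IsFactorCritical G R) {v : V}
    (hv : v ∈ R) (hleaf : (neighborsIn G S {p v}).Nonempty)
    (hother : (neighborsIn G S (D.erase (p v))).Nonempty) : HasPathCover G U := by
  refine h.hasPathCover_of_split hrest hD hleaf hother
    (neighborsIn_singleton_union_erase (hDR.leaf_mem hv))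
    (fun s hs _ => hprivate s (neighborsIn_subset hs)) ?_
  intro s hs t ht hst X hX Y hY hXY hXD hYD hsX htY
  obtain ⟨hsS, hsv⟩ := mem_neighborsIn_singleton.1 hs
  obtain ⟨htS, x, hx, htx⟩ := mem_neighborsIn.1 ht
  obtain ⟨hxv, hxD⟩ := Finset.mem_erase.1 hx
  exact hDR.hasPathCover_of_arms_leaf hR hv hxD hxv hsv htx (hasArm_of_mem_neighborsIn hX hsX)
    (hasArm_of_mem_neighborsIn hY htY) (notMem_of_mem_suns hX hsS) (notMem_of_mem_suns hY htS)
    (disjoint_insert_insert_of_mem_suns hX hY hXY hsS htS hst)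
    (disjoint_insert_of_mem_suns hX hD hXD hsS) (disjoint_insert_of_mem_suns hY hD hYD htS)

theorem hasPathCover_of_only_leaf_attached (h : IsNearBarrier G U S)
    (hrest : HasPathCover G (nonSunPart G U S))
    (hprivate : ∀ s ∈ S, ∃ E ∈ suns G (U \ S), E ≠ D ∧ neighborsIn G S E = {s})
    (hD : D ∈ suns G (U \ S)) (hDR : IsCorona G D R p) (hR : IsFactorCritical G R) {v : V}
    (hv : v ∈ R) (hleaf : (neighborsIn G S {p v}).Nonempty)
    (hother : neighborsIn G S (D.erase (p v)) = ∅) (hcard : 2 ≤ R.card) : HasPathCover G U := by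
  have hunion := neighborsIn_singleton_union_erase (G := G) (S := S) (hDR.leaf_mem hv)
  rw [hother, Finset.union_empty] at hunion
  exact h.hasPathCover_of_hub hrest hD (hDR.leaf_mem hv) (hDR.hasPathCover_erase_leaf hR hv hcard)
    hleaf hleaf subset_rfl subset_rfl (by rwa [Finset.union_self])
    fun s hs _ => hprivate s (neighborsIn_subset hs)

theorem exists_isCorona_leaf_not_adj (h : IsNearBarrier G U S)
    (hrest : HasPathCover G (nonSunPart G U S)) (hno : ¬ HasPathCover G U)
    (hprivate : ∀ s ∈ S, ∃ E ∈ suns G (U \ S), E ≠ D ∧ neighborsIn G S E = {s})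
    (hD : D ∈ suns G (U \ S)) (hcard : 2 ≤ D.card) :
    ∃ R p, IsCorona G D R p ∧ Odd R.card ∧ ∀ v ∈ R, ∀ s ∈ S, ¬ G.Adj s (p v) := by
  rcases isSun_of_mem_suns hD with ⟨v, rfl⟩ | ⟨R, p, hDR, hR⟩
  · simp at hcard
  by_cases hatt : ∀ v ∈ R, ∀ s ∈ S, ¬ G.Adj s (p v)
  · exact ⟨R, p, hDR, hR.odd_card, hatt⟩
  push Not at hatt
  obtain ⟨v, hv, s, hs, hsv⟩ := hatt
  have hleaf : (neighborsIn G S {p v}).Nonempty := ⟨s, mem_neighborsIn_singleton.2 ⟨hs, hsv⟩⟩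
  have hother : neighborsIn G S (D.erase (p v)) = ∅ := Finset.not_nonempty_iff_eq_empty.1
    fun hother => hno (h.hasPathCover_of_leaf_attached hrest hprivate hD hDR hR hv hleaf hother)
  have hRcard : R.card = 1 := by
    refine le_antisymm ?_ hR.1.card_pos
    by_contra! hRcard
    exact hno (h.hasPathCover_of_only_leaf_attached hrest hprivate hD hDR hR hv hleaf hother hRcard)
  obtain ⟨w, rfl⟩ := Finset.card_eq_one.1 hRcard
  obtain rfl := Finset.mem_singleton.1 hv
  refine ⟨{p v}, fun _ => v, hDR.swap_of_singleton, by simp, fun _ _ t ht htv => ?_⟩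
  have hmem : t ∈ neighborsIn G S (D.erase (p v)) := mem_neighborsIn.2
    ⟨ht, v, Finset.mem_erase.2 ⟨hDR.ne_leaf hv hv, hDR.mem_of_mem_core hv⟩, htv⟩
  simp [hother] at hmem

theorem isPendantCorona_singleton (h : IsNearBarrier G U S) {a s : V} (ha : {a} ∈ suns G (U \ S))
    (has : neighborsIn G S {a} = {s}) : IsPendantCorona G U {s, a} {s} fun _ => a := by
  obtain ⟨hs, hsa⟩ := mem_neighborsIn_singleton.1 (has ▸ Finset.mem_singleton_self s)
  have haU : a ∈ U := Finset.sdiff_subset (subset_of_mem_suns ha (Finset.mem_singleton_self a))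
  have hsubset : ({s, a} : Finset V) ⊆ U := by grind [h.subset]
  have hpendant : ∀ y ∈ U, G.Adj a y → y = s := by
    intro y hy hay
    by_cases hyS : y ∈ S
    · exact Finset.mem_singleton.1 (has ▸ mem_neighborsIn_singleton.2 ⟨hyS, hay.symm⟩)
    · have hya := isClosedIn_of_mem_suns ha a (Finset.mem_singleton_self a) y
        (Finset.mem_sdiff.2 ⟨hy, hyS⟩) hay
      exact absurd (Finset.mem_singleton.1 hya) hay.ne'
  refine ⟨⟨by simp, by simpa using hsa.ne', by simp, by simpa using hsa, ?_⟩, hsubset, ?_⟩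
  · simp
  · simpa using hpendant

theorem exists_isPendantCorona_extendedSun (h : IsNearBarrier G U S)
    (hrest : nonSunPart G U S = ∅) (hno : ¬ HasPathCover G U) (hC : C ∈ suns G (U \ S)) :
    ∃ R p, IsPendantCorona G U (extendedSun G S C) R p ∧ Odd R.card := by
  by_cases hcard : C.card = 1
  · rw [extendedSun, if_pos hcard]
    obtain ⟨a, rfl⟩ := Finset.card_eq_one.1 hcard
    obtain ⟨s, hs⟩ := neighborsIn_nonempty h.sunCondition h.strict h.subset hC
    have has := h.neighborsIn_singleton_eq (hrest ▸ .empty) hno hC hs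
    rw [has, Finset.union_comm, ← Finset.insert_eq]
    exact ⟨{s}, fun _ => a, h.isPendantCorona_singleton hC has, by simp⟩
  · rw [extendedSun, if_neg hcard]
    have hprivate : ∀ s ∈ S, ∃ E ∈ suns G (U \ S), E ≠ C ∧ neighborsIn G S E = {s} := by
      intro s hs
      obtain ⟨a, ha, has⟩ := h.exists_singleton_mem_suns hrest hno hs
      exact ⟨{a}, ha, by rintro rfl; exact hcard (Finset.card_singleton a), has⟩
    obtain ⟨R, p, hCR, hodd, hleaf⟩ := h.exists_isCorona_leaf_not_adj (hrest ▸ .empty) hno hprivate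
      hC (Nat.lt_of_le_of_ne (nonempty_of_mem_suns hC).card_pos (Ne.symm hcard))
    refine ⟨R, p, ⟨hCR, (subset_of_mem_suns hC).trans Finset.sdiff_subset, ?_⟩, hodd⟩
    intro v hv y hy hvy
    have hyS : y ∉ S := fun hyS => hleaf v hv y hyS hvy.symm
    exact hCR.eq_of_leaf_adj v hv y (isClosedIn_of_mem_suns hC _ (hCR.leaf_mem hv) y
      (Finset.mem_sdiff.2 ⟨hy, hyS⟩) hvy) hvy

theorem pairwiseDisjoint_extendedSun (h : IsNearBarrier G U S) (hrest : nonSunPart G U S = ∅)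
    (hno : ¬ HasPathCover G U) :
    (suns G (U \ S) : Set (Finset V)).PairwiseDisjoint (extendedSun G S) := by
  intro C hC D hD hCD
  refine Finset.disjoint_left.2 fun x hxC hxD => hCD ?_
  rw [mem_extendedSun] at hxC hxD
  rcases hxC with hxC | ⟨hC1, hxC⟩ <;> rcases hxD with hxD | ⟨hD1, hxD⟩
  · exact suns_eq hC hD hxC hxD
  · exact absurd hxC (notMem_of_mem_suns hC (neighborsIn_subset hxD))
  · exact absurd hxD (notMem_of_mem_suns hD (neighborsIn_subset hxC))
  · obtain ⟨a, rfl⟩ := Finset.card_eq_one.1 hC1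
    obtain ⟨b, rfl⟩ := Finset.card_eq_one.1 hD1
    exact h.eq_of_neighborsIn_eq_singleton (neighborsIn_subset hxC) hC hD
      (h.neighborsIn_singleton_eq (hrest ▸ .empty) hno hC hxC)
      (h.neighborsIn_singleton_eq (hrest ▸ .empty) hno hD hxD)

theorem biUnion_extendedSun (h : IsNearBarrier G U S) (hrest : nonSunPart G U S = ∅)
    (hno : ¬ HasPathCover G U) : (suns G (U \ S)).biUnion (extendedSun G S) = U := by
  refine Finset.Subset.antisymm (Finset.biUnion_subset.2 fun C hC => ?_) fun x hx => ?_
  · obtain ⟨R, p, hRp, -⟩ := h.exists_isPendantCorona_extendedSun hrest hno hC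
    exact hRp.subset
  · rw [Finset.mem_biUnion]
    by_cases hxS : x ∈ S
    · obtain ⟨a, ha, hax⟩ := h.exists_singleton_mem_suns hrest hno hxS
      exact ⟨{a}, ha, mem_extendedSun.2 (Or.inr ⟨Finset.card_singleton a, by simp [hax]⟩)⟩
    · have hxrest : x ∉ nonSunPart G U S := hrest ▸ Finset.notMem_empty x
      simp only [mem_nonSunPart, not_and, not_forall, not_not] at hxrest
      obtain ⟨C, hC, hxC⟩ := hxrest ⟨hx, hxS⟩
      exact ⟨C, hC, mem_extendedSun.2 (Or.inl hxC)⟩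

-- Otherwise `U` would be a corona of odd order, which violates `SunCondition`.
theorem hasPathCover_of_nonSunPart_eq_empty (h : IsNearBarrier G U S)
    (hrest : nonSunPart G U S = ∅) : HasPathCover G U := by
  by_contra hno
  obtain ⟨R, p, hRp, hodd⟩ := exists_isPendantCorona_biUnion (suns G (U \ S)) (extendedSun G S)
    (h.pairwiseDisjoint_extendedSun hrest hno)
    fun C hC => h.exists_isPendantCorona_extendedSun hrest hno hC
  rw [h.biUnion_extendedSun hrest hno] at hRp
  have hcard := h.card_add_one
  exact hRp.not_sunCondition (hodd.2 (by rw [Nat.odd_iff]; lia)) h.sunCondition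

end IsNearBarrier

end NearBarriers

section Kaneko

variable {V : Type*} [DecidableEq V] {G : SimpleGraph V} {U S K : Finset V}

theorem nonSunPart_subset_sdiff : nonSunPart G U S ⊆ U \ S :=
  fun _ hx => Finset.mem_sdiff.2 (mem_nonSunPart.1 hx).1

theorem card_nonSunPart_lt (hS : S ⊆ U) (hS0 : S.Nonempty) : (nonSunPart G U S).card < U.card :=
  (Finset.card_le_card nonSunPart_subset_sdiff).trans_lt
    (Finset.card_lt_card (Finset.sdiff_ssubset hS hS0))

theorem SunCondition.nonSunPart_of_card_eq (hG : SunCondition G U) (hS : S ⊆ U)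
    (hcard : (suns G (U \ S)).card = 2 * S.card) : SunCondition G (nonSunPart G U S) := by
  intro T hT
  have hadd := card_suns_nonSunPart_sdiff_add hT
  have hST := hG (S ∪ T) (Finset.union_subset hS (hT.trans nonSunPart_subset))
  have hle := Finset.card_union_le S T
  lia

theorem SunCondition.exists_adj (hG : SunCondition G U) (hU : IsConnectedOn G U) :
    ∃ x ∈ U, ∃ y ∈ U, G.Adj x y := by
  obtain ⟨x, hx⟩ := hU.1
  have hne : {x} ≠ U := by
    rintro rfl
    have hmem : {x} ∈ suns G ({x} \ ∅) := singleton_mem_suns (by simp) (by simp)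
    have hle := hG ∅ (Finset.empty_subset _)
    have hpos := Finset.card_pos.2 ⟨_, hmem⟩
    rw [Finset.card_empty] at hle
    lia
  obtain ⟨z, hz, y, hy, -, hzy⟩ := hU.exists_adj (Finset.singleton_subset_iff.2 hx)
    (Finset.singleton_nonempty x) hne
  exact ⟨x, hx, y, hy, Finset.mem_singleton.1 hz ▸ hzy⟩

theorem SunCondition.hasPathCover_of_not_isConnectedOn (hG : SunCondition G U)
    (hU : ¬ IsConnectedOn G U) (hU0 : U.Nonempty)
    (ih : ∀ U' : Finset V, U'.card < U.card → SunCondition G U' → HasPathCover G U') :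
    HasPathCover G U := by
  simp only [IsConnectedOn, hU0, true_and, not_forall] at hU
  obtain ⟨D, hDU, hD0, hcl, hne⟩ := hU
  exact (ih D (Finset.card_lt_card (hDU.ssubset_of_ne hne)) (hG.of_isClosedIn hDU hcl)).of_sdiff
    (ih _ (Finset.card_lt_card (Finset.sdiff_ssubset hDU hD0))
      (hG.of_isClosedIn Finset.sdiff_subset hcl.sdiff)) hDU

theorem comps_subset_nonSunPart (hK : K ∈ comps G (U \ S)) (hsun : ¬ IsSun G K) :
    K ⊆ nonSunPart G U S := fun _ hy =>
  mem_nonSunPart.2 ⟨Finset.mem_sdiff.1 ((mem_comps.1 hK).1 hy), fun _ hC hyC =>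
    hsun (comps_eq (suns_subset_comps hC) hK hyC hy ▸ isSun_of_mem_suns hC)⟩

theorem exists_mem_comps_not_isSun {x : V} (hx : x ∈ nonSunPart G U S) :
    ∃ K ∈ comps G (U \ S), ¬ IsSun G K := by
  obtain ⟨hxUS, hxsun⟩ := mem_nonSunPart.1 hx
  obtain ⟨K, hK, hxK⟩ := exists_mem_comps (Finset.mem_sdiff.2 hxUS)
  exact ⟨K, hK, fun hsun => hxsun K (mem_suns.2 ⟨hK, hsun⟩) hxK⟩

theorem IsConnectedOn.exists_adj_of_mem_comps_sdiff (hU : IsConnectedOn G U) (hS : S ⊆ U)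
    (hS0 : S.Nonempty) (hK : K ∈ comps G (U \ S)) : ∃ z ∈ K, ∃ s ∈ S, G.Adj s z := by
  obtain ⟨hKU, hKconn, hKcl⟩ := mem_comps.1 hK
  have hne : K ≠ U := by
    rintro rfl
    obtain ⟨s, hs⟩ := hS0
    exact (Finset.mem_sdiff.1 (hKU (hS hs))).2 hs
  obtain ⟨z, hz, s, hsU, hsK, hzs⟩ :=
    hU.exists_adj (hKU.trans Finset.sdiff_subset) hKconn.1 hne
  refine ⟨z, hz, s, ?_, hzs.symm⟩
  by_contra hsS
  exact hsK (hKcl z hz s (Finset.mem_sdiff.2 ⟨hsU, hsS⟩) hzs)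

namespace IsNearBarrier

theorem nonempty (h : IsNearBarrier G U S) : S.Nonempty := by
  have := h.card_add_one
  exact Finset.card_pos.1 (by lia)

theorem sunCondition_nonSunPart (h : IsNearBarrier G U S) : SunCondition G (nonSunPart G U S) := by
  intro T hT
  have hadd := card_suns_nonSunPart_sdiff_add hT
  have hST := h.strict (S ∪ T) (Finset.union_subset h.subset (hT.trans nonSunPart_subset))
    (h.nonempty.mono Finset.subset_union_left)
  have hle := Finset.card_union_le S T
  have hcard := h.card_add_one
  lia

theorem strict_nonSunPart (h : IsNearBarrier G U S)
    (hmax : ∀ T, IsNearBarrier G U T → T.card ≤ S.card) :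
    StrictSunCondition G (nonSunPart G U S) := by
  intro T hT hT0
  have hadd := card_suns_nonSunPart_sdiff_add hT
  have hsub := Finset.union_subset h.subset (hT.trans nonSunPart_subset)
  have hST := h.strict (S ∪ T) hsub (h.nonempty.mono Finset.subset_union_left)
  have hunion : (S ∪ T).card = S.card + T.card := Finset.card_union_of_disjoint <|
    Finset.disjoint_left.2 fun y hy hyT => (mem_nonSunPart.1 (hT hyT)).1.2 hy
  have hpos := hT0.card_pos
  have hne : (suns G (U \ (S ∪ T))).card + 1 ≠ 2 * (S ∪ T).card := fun heq => by
    have := hmax (S ∪ T) ⟨h.sunCondition, h.strict, hsub, heq⟩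
    lia
  have hcard := h.card_add_one
  lia

theorem hasPathCover_nonSunPart_union_insert_singleton (h : IsNearBarrier G U S)
    (hmax : ∀ T, IsNearBarrier G U T → T.card ≤ S.card)
    (ih : ∀ G' ≤ G, ∀ U' : Finset V, U'.card < U.card → SunCondition G' U' → HasPathCover G' U')
    (hK : K ∈ comps G (U \ S)) (hKsun : ¬ IsSun G K) {s z w : V} (hs : s ∈ S) (hz : z ∈ K)
    (hsz : G.Adj s z) (hw : {w} ∈ suns G (U \ S)) (hsw : G.Adj s w) :
    HasPathCover G (nonSunPart G U S ∪ insert s {w}) := by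
  obtain ⟨hKU, hKconn, hKcl⟩ := mem_comps.1 hK
  have hKrest := comps_subset_nonSunPart hK hKsun
  have hKcl' : IsClosedIn G (nonSunPart G U S) K := hKcl.mono nonSunPart_subset_sdiff
  have hsrest : s ∉ nonSunPart G U S := fun hmem => (mem_nonSunPart.1 hmem).1.2 hs
  have hwrest : w ∉ nonSunPart G U S := fun hmem =>
    (mem_nonSunPart.1 hmem).2 _ hw (Finset.mem_singleton_self w)
  have hwU : w ∈ U := Finset.sdiff_subset (subset_of_mem_suns hw (Finset.mem_singleton_self w))
  have hsK : insert s K ⊂ U := by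
    refine Finset.ssubset_iff_of_subset
      (Finset.insert_subset (h.subset hs) (hKU.trans Finset.sdiff_subset)) |>.2 ⟨w, hwU, ?_⟩
    exact Finset.mem_insert.not.2 (not_or.2 ⟨hsw.ne', fun hwK => hwrest (hKrest hwK)⟩)
  have hcover := hasPathCover_insert_insert hKconn hKsun
    ((h.strict_nonSunPart hmax).of_isClosedIn hKrest hKcl') hz (fun hsK => hsrest (hKrest hsK))
    (fun hwK => hwrest (hKrest hwK)) hsw.symm hsz
    fun G' hle => ih G' hle _ (Finset.card_lt_card hsK)
  refine hcover.of_sdiff ?_ (by grind)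
  have hlt := (Finset.card_le_card (Finset.sdiff_subset (t := K))).trans_lt
    (card_nonSunPart_lt (G := G) h.subset h.nonempty)
  have hother := ih G le_rfl _ hlt
    (h.sunCondition_nonSunPart.of_isClosedIn Finset.sdiff_subset hKcl'.sdiff)
  convert hother using 1
  grind

theorem hasPathCover_of_maximal (h : IsNearBarrier G U S)
    (hmax : ∀ T, IsNearBarrier G U T → T.card ≤ S.card) (hU : IsConnectedOn G U)
    (ih : ∀ G' ≤ G, ∀ U' : Finset V, U'.card < U.card → SunCondition G' U' → HasPathCover G' U') :
    HasPathCover G U := by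
  rcases (nonSunPart G U S).eq_empty_or_nonempty with hrest | ⟨x, hx⟩
  · exact h.hasPathCover_of_nonSunPart_eq_empty hrest
  obtain ⟨K, hK, hKsun⟩ := exists_mem_comps_not_isSun hx
  obtain ⟨z, hz, s, hs, hsz⟩ := hU.exists_adj_of_mem_comps_sdiff h.subset h.nonempty hK
  obtain ⟨C, hC, hsC, himp⟩ := h.exists_mem_suns_hasPathCover_imp hs
  obtain ⟨-, w, hw, hsw⟩ := mem_neighborsIn.1 hsC
  refine himp ?_
  rcases Nat.lt_or_ge 1 C.card with hcard | hcard
  · have hdisj : Disjoint (nonSunPart G U S) (insert s C) := Finset.disjoint_insert_right.2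
      ⟨fun hmem => (mem_nonSunPart.1 hmem).1.2 hs,
        Finset.disjoint_left.2 fun y hy => (mem_nonSunPart.1 hy).2 C hC⟩
    exact (ih G le_rfl _ (card_nonSunPart_lt h.subset h.nonempty) h.sunCondition_nonSunPart).union
      ((isSun_of_mem_suns hC).hasPathCover_insert hcard hw hsw (notMem_of_mem_suns hC hs)) hdisj
  · obtain rfl : C = {w} := Finset.eq_singleton_iff_unique_mem.2
      ⟨hw, fun y hy => Finset.card_le_one.1 hcard y hy w hw⟩
    exact h.hasPathCover_nonSunPart_union_insert_singleton hmax ih hK hKsun hs hz hsz hC hsw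

end IsNearBarrier

-- Sufficiency in Kaneko's theorem on `P_{≥3}`-factors.
theorem SunCondition.hasPathCover [Finite V] (hG : SunCondition G U) : HasPathCover G U := by
  induction hn : U.card + G.edgeSet.ncard using Nat.strong_induction_on generalizing G U with
  | _ n ih =>
  subst hn
  have ihU : ∀ G' ≤ G, ∀ U' : Finset V, U'.card < U.card → SunCondition G' U' →
      HasPathCover G' U' := fun G' hle U' hU' hG' =>
    ih _ (add_lt_add_of_lt_of_le hU' (Set.ncard_le_ncard (SimpleGraph.edgeSet_mono hle))) hG' rfl
  rcases U.eq_empty_or_nonempty with rfl | hU0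
  · exact .empty
  by_cases hU : IsConnectedOn G U
  swap
  · exact hG.hasPathCover_of_not_isConnectedOn hU hU0 (ihU G le_rfl)
  by_cases hstrict : StrictSunCondition G U
  swap
  · simp only [StrictSunCondition, not_forall, not_lt] at hstrict
    obtain ⟨S, hS, hS0, hle⟩ := hstrict
    have hcard := le_antisymm (hG S hS) hle
    exact hasPathCover_of_card_eq_two_mul hG hS hcard
      (ihU G le_rfl _ (card_nonSunPart_lt hS hS0) (hG.nonSunPart_of_card_eq hS hcard))
  by_cases hnear : ∃ S, IsNearBarrier G U S
  · obtain ⟨S, hS, hmax⟩ := Set.exists_max_image {S | IsNearBarrier G U S} Finset.card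
      (Set.toFinite _) hnear
    exact hS.hasPathCover_of_maximal hmax hU ihU
  · have hbarrier : ∀ S ⊆ U, S.Nonempty → (suns G (U \ S)).card + 2 ≤ 2 * S.card := by
      intro S hS hS0
      have hlt := hstrict S hS hS0
      have hne : (suns G (U \ S)).card + 1 ≠ 2 * S.card := fun heq =>
        hnear ⟨S, hG, hstrict, hS, heq⟩
      lia
    obtain ⟨x, hx, y, hy, hxy⟩ := hG.exists_adj hU
    exact (ih _ (add_lt_add_right (ncard_edgeSet_deleteEdges_singleton_lt hxy) _)
      (.deleteEdges hU hbarrier hx hy hxy.ne) rfl).mono (SimpleGraph.deleteEdges_le _)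

end Kaneko

section Factor

variable {V W : Type*} {G F F' : SimpleGraph V} {H : SimpleGraph W}

/-- The image of the graph embedding is a union of connected components of the target. -/
def HasClosedRange (φ : H ↪g F) : Prop :=
  ∀ i v, F.Adj (φ i) v → v ∈ Set.range φ

theorem HasClosedRange.exists_sup {φ : H ↪g F} (hφ : HasClosedRange φ)
    (hF' : Disjoint (Set.range φ) F'.support) :
    ∃ ψ : H ↪g F ⊔ F', ⇑ψ = φ ∧ HasClosedRange ψ := by
  have hadj (i : W) (v : V) : (F ⊔ F').Adj (φ i) v ↔ F.Adj (φ i) v :=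
    or_iff_left fun h => Set.disjoint_left.1 hF' ⟨i, rfl⟩ ⟨v, h⟩
  exact ⟨⟨φ.toEmbedding, fun {i j} => (hadj i _).trans φ.map_adj_iff⟩, rfl,
    fun i v h => hφ i v ((hadj i v).1 h)⟩

theorem hasClosedRange_embedding_map (e : W ↪ V) (H : SimpleGraph W) :
    HasClosedRange (SimpleGraph.Embedding.map e H) := by
  rintro i v ⟨-, a, b, -, -, rfl⟩
  exact ⟨b, rfl⟩

theorem HasClosedRange.mem_range_of_reachable {φ : H ↪g F} (hφ : HasClosedRange φ) {u v : V}
    (hu : u ∈ Set.range φ) (huv : F.Reachable u v) : v ∈ Set.range φ := by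
  obtain ⟨p⟩ := huv
  induction p with
  | nil => exact hu
  | cons huw _ ih =>
    obtain ⟨i, rfl⟩ := hu
    exact ih (hφ i _ huw)

theorem HasClosedRange.nonempty_iso_toSimpleGraph {φ : H ↪g F} (hφ : HasClosedRange φ)
    (hH : H.Connected) {C : F.ConnectedComponent} {u : V} (hu : u ∈ Set.range φ)
    (huC : u ∈ C.supp) : Nonempty (C.toSimpleGraph ≃g H) := by
  obtain ⟨i, rfl⟩ := hu
  have hmem (j : W) : φ j ∈ C.supp :=
    (SimpleGraph.ConnectedComponent.sound ((hH.preconnected j i).map φ.toHom)).trans huC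
  have hbij : Function.Bijective fun j => (⟨φ j, hmem j⟩ : C.supp) := by
    refine ⟨fun j k hjk => φ.injective (congrArg Subtype.val hjk), fun ⟨v, hv⟩ => ?_⟩
    obtain ⟨j, hj⟩ := hφ.mem_range_of_reachable ⟨i, rfl⟩ (C.reachable_of_mem_supp huC hv)
    exact ⟨j, Subtype.ext hj⟩
  exact ⟨RelIso.symm ⟨Equiv.ofBijective _ hbij, φ.map_adj_iff⟩⟩

theorem map_pathGraph_le_of_isChain {l : List V} (hl : l.IsChain G.Adj)
    (e : Fin l.length ↪ V) (he : ∀ i, e i = l.get i) :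
    (SimpleGraph.pathGraph l.length).map e ≤ G := by
  have hsucc : ∀ i j : Fin l.length, i.val + 1 = j.val → G.Adj (e i) (e j) := by
    rintro i ⟨j, hj⟩ rfl
    rw [he, he]
    exact List.isChain_iff_getElem.1 hl i.val hj
  rw [SimpleGraph.map_le_iff_le_comap]
  intro i j hij
  rcases SimpleGraph.pathGraph_adj.1 hij with hij | hij
  · exact hsucc i j hij
  · exact (hsucc j i hij).symm

theorem support_map_subset_range (e : W ↪ V) (H : SimpleGraph W) :
    (H.map e).support ⊆ Set.range e := by
  rintro v ⟨w, -, i, j, -, rfl, -⟩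
  exact ⟨i, rfl⟩

variable [DecidableEq V]

theorem HasPathCover.exists_hasClosedRange {U : Finset V} (h : HasPathCover G U) :
    ∃ F ≤ G, F.support ⊆ U ∧ ∀ u ∈ U, ∃ m, 3 ≤ m ∧ ∃ φ : SimpleGraph.pathGraph m ↪g F,
      u ∈ Set.range φ ∧ Set.range φ ⊆ U ∧ HasClosedRange φ := by
  induction h with
  | empty => exact ⟨⊥, bot_le, by simp, by simp⟩
  | @cons U l hchain hnodup hlen hdisj _ ih =>
    obtain ⟨F, hFG, hFU, hF⟩ := ih
    let e : Fin l.length ↪ V := ⟨l.get, List.nodup_iff_injective_get.1 hnodup⟩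
    let P := (SimpleGraph.pathGraph l.length).map e
    have he : Set.range e = l.toFinset := by
      rw [List.coe_toFinset]
      exact Set.range_list_get l
    have hP : P.support ⊆ l.toFinset := he ▸ support_map_subset_range e _
    have hdisj : Disjoint (l.toFinset : Set V) U := Finset.disjoint_coe.2 hdisj
    rw [Finset.coe_union]
    refine ⟨F ⊔ P, sup_le hFG (map_pathGraph_le_of_isChain hchain e fun _ => rfl), ?_, ?_⟩
    · rintro u ⟨v, huv | huv⟩
      · exact Or.inr (hFU ⟨v, huv⟩)
      · exact Or.inl (hP ⟨v, huv⟩)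
    · intro u hu
      rcases Finset.mem_union.1 hu with hu | hu
      · have hrange : Set.range (SimpleGraph.Embedding.map e (SimpleGraph.pathGraph _)) =
          l.toFinset := he
        obtain ⟨ψ, hψ, hψc⟩ := (hasClosedRange_embedding_map e _).exists_sup
          (hrange ▸ hdisj.mono_right hFU)
        rw [sup_comm]
        exact ⟨l.length, hlen, ψ, by rw [hψ, hrange]; exact hu,
          by rw [hψ, hrange]; exact Set.subset_union_left, hψc⟩
      · obtain ⟨m, hm, φ, huφ, hφU, hφ⟩ := hF u hu
        obtain ⟨ψ, hψ, hψc⟩ := hφ.exists_sup (hdisj.symm.mono hφU hP)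
        rw [← hψ] at huφ hφU
        exact ⟨m, hm, ψ, huφ, hφU.trans Set.subset_union_right, hψc⟩

theorem HasPathCover.exists_isPathFactor [Fintype V] (h : HasPathCover G Finset.univ) :
    ∃ F, IsPathFactor G F 3 := by
  obtain ⟨F, hFG, -, hF⟩ := h.exists_hasClosedRange
  refine ⟨F, hFG, fun C => ?_⟩
  obtain ⟨u, hu⟩ := C.nonempty_supp
  obtain ⟨m, hm, φ, huφ, -, hφ⟩ := hF u (Finset.mem_univ u)
  obtain ⟨k, rfl⟩ : ∃ k, m = k + 1 := ⟨m - 1, by lia⟩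
  exact ⟨k + 1, hm, hφ.nonempty_iso_toSimpleGraph (SimpleGraph.pathGraph_connected k) huφ hu⟩

end Factor

section Toughness

variable {V : Type*} {G : SimpleGraph V} {U C : Finset V} {x y : V}

theorem IsConnectedOn.card_comps_le_one (hU : IsConnectedOn G U) : (comps G U).card ≤ 1 := by
  refine Finset.card_le_one.2 fun C hC D hD => ?_
  have heq {C : Finset V} (hC : C ∈ comps G U) : C = U :=
    hU.2 C (mem_comps.1 hC).1 (mem_comps.1 hC).2.1.1 (mem_comps.1 hC).2.2
  rw [heq hC, heq hD]

section Fintype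

variable [Fintype V] [DecidableEq V]

theorem numComponents_deleteVerts (G : SimpleGraph V) (X : Finset V) :
    numComponents (deleteVerts G X) = (comps G Xᶜ).card := by
  obtain ⟨Φ, -⟩ := exists_connectedComponent_equiv_comps (B := Xᶜ)
    (SimpleGraph.Embedding.induce (G := G) (X : Set V)ᶜ) (by ext; simp)
  rw [numComponents, Nat.card_congr Φ, Nat.card_eq_fintype_card, Fintype.card_coe]

theorem isConnectedOn_compl_of_connected {X : Finset V} (h : (deleteVerts G X).Connected) :
    IsConnectedOn G Xᶜ := by
  have hcard : (comps G Xᶜ).card = 1 := by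
    rw [← numComponents_deleteVerts, numComponents, Nat.card_eq_one_iff_unique]
    have := h.nonempty
    exact ⟨h.preconnected.subsingleton_connectedComponent, inferInstance⟩
  obtain ⟨C, hC⟩ := Finset.card_eq_one.1 hcard
  have hunion := biUnion_comps G Xᶜ
  rw [hC, Finset.singleton_biUnion, id] at hunion
  rw [← hunion]
  exact (mem_comps.1 (hC ▸ Finset.mem_singleton_self C : C ∈ comps G Xᶜ)).2.1

end Fintype

theorem card_filter_mem_comps_deleteEdges_le [DecidableEq V] :
    ((comps (G.deleteEdges {s(x, y)}) U).filter fun C => x ∈ C).card ≤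
      ((comps G U).filter fun C => x ∈ C).card := by
  by_cases hx : x ∈ U
  · obtain ⟨C, hC, hxC⟩ := exists_mem_comps (G := G) hx
    exact (card_filter_mem_comps_le_one _ _ _).trans
      (Finset.card_pos.2 ⟨C, Finset.mem_filter.2 ⟨hC, hxC⟩⟩)
  · rw [Finset.filter_eq_empty_iff.2 fun C hC hxC => hx ((mem_comps.1 hC).1 hxC)]
    exact Nat.zero_le _

theorem card_comps_deleteEdges_le (G : SimpleGraph V) (U : Finset V) (x y : V) :
    (comps (G.deleteEdges {s(x, y)}) U).card ≤ (comps G U).card + 1 := by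
  classical
  have hsub : ((comps (G.deleteEdges {s(x, y)}) U).filter fun C => x ∉ C) ⊆
      ((comps G U).filter fun C => x ∉ C) ∪
        ((comps (G.deleteEdges {s(x, y)}) U).filter fun C => y ∈ C) := by
    intro C hC
    rw [Finset.mem_filter] at hC
    simp only [Finset.mem_union, Finset.mem_filter, hC, true_and, not_false_eq_true, and_true]
    by_contra! hnot
    exact hnot.1 (comps_congr hC.1 fun u hu v _ =>
      deleteEdges_singleton_adj_iff_of_notMem hC.2 hnot.2 hu v)
  have hcard := (Finset.card_le_card hsub).trans (Finset.card_union_le _ _)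
  have hx := card_filter_mem_comps_deleteEdges_le (G := G) (U := U) (x := x) (y := y)
  have hy := card_filter_mem_comps_le_one (G.deleteEdges {s(x, y)}) U y
  have hsplit := Finset.card_filter_add_card_filter_not (s := comps G U) fun C => x ∈ C
  have hsplit' :=
    Finset.card_filter_add_card_filter_not (s := comps (G.deleteEdges {s(x, y)}) U) fun C => x ∈ C
  lia

variable [DecidableEq V]

theorem not_isSun_deleteEdges (hU : ∀ v ∈ U, IsConnectedOn G (U.erase v)) (hcard : 3 ≤ U.card) :
    ¬ IsSun (G.deleteEdges {s(x, y)}) U := by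
  intro hsun
  obtain ⟨l, hl, m, hm, hlx, hly, hlm, hleaf⟩ := hsun.exists_leaf_notMem_pair hcard x y
  have hclosed : IsClosedIn G (U.erase m) {l} := by
    intro a ha b hb hab
    obtain rfl := Finset.mem_singleton.1 ha
    rw [Finset.mem_erase] at hb
    refine absurd (hleaf b hb.2 (deleteEdges_singleton_adj.2 ⟨hab, ?_⟩)) hb.1
    rw [Ne, Sym2.eq_iff]
    tauto
  have hsingle := (hU m hm).2 {l} (by simp [hl, hlm]) (Finset.singleton_nonempty l) hclosed
  have herase := Finset.card_erase_add_one hm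
  rw [← hsingle, Finset.card_singleton] at herase
  lia

theorem subset_singleton_of_isClosedIn_deleteEdges (hU : IsConnectedOn G (U.erase x))
    (hC : C ⊆ U) (hclosed : IsClosedIn (G.deleteEdges {s(x, y)}) U C) (hyU : y ∈ U)
    (hxy : x ≠ y) (hy : y ∉ C) : C ⊆ {x} := by
  by_contra hnot
  have hne : (C.erase x).Nonempty := by
    obtain ⟨a, haC, hax⟩ := Finset.not_subset.1 hnot
    exact ⟨a, Finset.mem_erase.2 ⟨by simpa using hax, haC⟩⟩
  have hclosed' : IsClosedIn G (U.erase x) (C.erase x) := by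
    intro u hu w hw huw
    rw [Finset.mem_erase] at hu hw ⊢
    refine ⟨hw.1, hclosed u hu.2 w hw.2 (deleteEdges_singleton_adj.2 ⟨huw, fun he => ?_⟩)⟩
    rw [Sym2.eq_iff] at he
    tauto
  have heq := hU.2 (C.erase x) (Finset.erase_subset_erase x hC) hne hclosed'
  exact hy (Finset.mem_of_mem_erase (heq ▸ Finset.mem_erase.2 ⟨hxy.symm, hyU⟩))

theorem eq_of_isClosedIn_deleteEdges (hU : IsConnectedOn G U)
    (hU' : ∀ v ∈ U, IsConnectedOn G (U.erase v)) (hcard : 3 ≤ U.card) (hC : C ⊆ U)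
    (hne : C.Nonempty) (hclosed : IsClosedIn (G.deleteEdges {s(x, y)}) U C) : C = U := by
  by_contra hCU
  obtain ⟨a, ha, b, hb, hbC, hab⟩ := hU.exists_adj hC hne hCU
  have hedge : s(x, y) = s(a, b) := by
    by_contra hne
    exact hbC (hclosed a ha b hb (deleteEdges_singleton_adj.2 ⟨hab, Ne.symm hne⟩))
  rw [hedge] at hclosed
  have hCa : C ⊆ {a} :=
    subset_singleton_of_isClosedIn_deleteEdges (hU' a (hC ha)) hC hclosed hb hab.ne hbC
  have hCb : U \ C ⊆ {b} :=
    subset_singleton_of_isClosedIn_deleteEdges (hU' b hb) Finset.sdiff_subset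
      (Sym2.eq_swap ▸ hclosed.sdiff) (hC ha) hab.ne.symm (by simp [ha])
  have hCa := Finset.card_le_card hCa
  have hCb := Finset.card_le_card hCb
  have hsum := Finset.card_sdiff_add_card_eq_card hC
  simp only [Finset.card_singleton] at hCa hCb
  lia

theorem suns_deleteEdges_eq_empty (hU : IsConnectedOn G U)
    (hU' : ∀ v ∈ U, IsConnectedOn G (U.erase v)) (hcard : 3 ≤ U.card) :
    suns (G.deleteEdges {s(x, y)}) U = ∅ := by
  refine Finset.eq_empty_iff_forall_notMem.2 fun C hC => ?_
  obtain rfl := eq_of_isClosedIn_deleteEdges hU hU' hcard (subset_of_mem_suns hC)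
    (nonempty_of_mem_suns hC) (isClosedIn_of_mem_suns hC)
  exact not_isSun_deleteEdges hU' hcard (isSun_of_mem_suns hC)

end Toughness

section Avoidable

theorem natCast_div_le_natCast_div_iff {a b c d : ℕ} (hb : b ≠ 0) (hd : d ≠ 0) :
    (a : ℝ≥0∞) / b ≤ (c : ℝ≥0∞) / d ↔ a * d ≤ c * b := by
  rw [ENNReal.div_le_iff (by simpa using hb) (by simp), ← ENNReal.mul_div_right_comm,
    ENNReal.le_div_iff_mul_le (Or.inl (by simpa using hd)) (Or.inl (by simp))]
  norm_cast

variable {V : Type*} [Fintype V] {G : SimpleGraph V} {W : Finset V} {n r : ℕ}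

theorem HasPathCover.exists_isPathFactor_deleteVerts [DecidableEq V]
    (h : HasPathCover G Wᶜ) : ∃ F, IsPathFactor (deleteVerts G W) F 3 := by
  have hcover := h.preimage (Subtype.val : ((W : Set V)ᶜ : Set V) → V) Subtype.val_injective
    fun v hv => ⟨⟨v, by simpa using hv⟩, rfl⟩
  have huniv : (Wᶜ : Finset V).preimage (Subtype.val : ((W : Set V)ᶜ : Set V) → V)
      Subtype.val_injective.injOn = Finset.univ := by
    ext v
    have hv : v.1 ∉ W := v.2
    simpa using hv
  rw [huniv] at hcover
  exact hcover.exists_isPathFactor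

theorem toughness_le [DecidableEq V] {X : Finset V} (hX : 2 ≤ (comps G Xᶜ).card) :
    toughness G ≤ (X.card : ℝ≥0∞) / ((comps G Xᶜ).card : ℝ≥0∞) := by
  rw [← numComponents_deleteVerts] at hX ⊢
  exact iInf₂_le X hX

namespace IsVertexConnected

theorem isConnectedOn_compl [DecidableEq V] {k : ℕ} (hG : IsVertexConnected G k)
    {X : Finset V} (hX : X.card < k) : IsConnectedOn G Xᶜ :=
  isConnectedOn_compl_of_connected (hG.2 X hX)

theorem card_comps_compl_lt [DecidableEq V] (hG : IsVertexConnected G (n + r + 2))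
    (ht : ((n : ℝ≥0∞) + r + 2) / (2 * ((r : ℝ≥0∞) + 2)) < toughness G)
    {S : Finset V} (hS : S.Nonempty) {X : Finset V} (hX : X.card = n + S.card) :
    (comps G Xᶜ).card < 2 * S.card := by
  by_contra! hlt
  have hpos := hS.card_pos
  have hSr : r + 2 ≤ S.card := by
    by_contra! hsmall
    have := (hG.isConnectedOn_compl (X := X) (by lia)).card_comps_le_one
    lia
  have hratio : (X.card : ℝ≥0∞) / ((comps G Xᶜ).card : ℝ≥0∞) ≤
      ((n + r + 2 : ℕ) : ℝ≥0∞) / ((2 * (r + 2) : ℕ) : ℝ≥0∞) := by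
    rw [natCast_div_le_natCast_div_iff (by lia) (by lia), hX]
    nlinarith
  push_cast at hratio
  exact ((ht.trans_le (toughness_le (by lia))).trans_le hratio).false

theorem sunCondition_deleteEdges [DecidableEq V] (hG : IsVertexConnected G (n + r + 2))
    (ht : ((n : ℝ≥0∞) + r + 2) / (2 * ((r : ℝ≥0∞) + 2)) < toughness G) (hW : W.card = n)
    (x y : V) : SunCondition (G.deleteEdges {s(x, y)}) Wᶜ := by
  intro S hS
  rcases S.eq_empty_or_nonempty with rfl | hne
  · have hWcard : 3 ≤ Wᶜ.card := by
      have := hG.1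
      rw [Finset.card_compl]
      lia
    have herase : ∀ v ∈ Wᶜ, IsConnectedOn G (Wᶜ.erase v) := by
      intro v _
      rw [← Finset.compl_insert]
      exact hG.isConnectedOn_compl ((Finset.card_insert_le v W).trans_lt (by lia))
    rw [Finset.sdiff_empty,
      suns_deleteEdges_eq_empty (hG.isConnectedOn_compl (by lia)) herase hWcard]
    simp
  · have hdisj : Disjoint W S := Finset.disjoint_right.2 fun v hv => by simpa using hS hv
    have hcard : (W ∪ S).card = n + S.card := by rw [Finset.card_union_of_disjoint hdisj, hW]
    have hlt := hG.card_comps_compl_lt ht hne hcard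
    have hsuns : (suns (G.deleteEdges {s(x, y)}) (W ∪ S)ᶜ).card ≤ (comps G (W ∪ S)ᶜ).card + 1 :=
      (Finset.card_le_card suns_subset_comps).trans (card_comps_deleteEdges_le _ _ _ _)
    rw [Finset.sdiff_eq_inter_compl, ← Finset.compl_union]
    lia

theorem isPathFactorCriticalAvoidable (hG : IsVertexConnected G (n + r + 2))
    (ht : ((n : ℝ≥0∞) + r + 2) / (2 * ((r : ℝ≥0∞) + 2)) < toughness G) :
    IsPathFactorCriticalAvoidable G 3 n := by
  classical
  intro W hW e _
  induction e using Sym2.ind with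
  | _ x y =>
    obtain ⟨F, hF, hpaths⟩ :=
      (hG.sunCondition_deleteEdges ht hW x y).hasPathCover.exists_isPathFactor_deleteVerts
    exact ⟨F, ⟨fun a b hab => (deleteEdges_singleton_adj.1 (hF hab)).1, hpaths⟩,
      fun hxy => (deleteEdges_singleton_adj.1 (hF hxy)).2 rfl⟩

end IsVertexConnected

end Avoidable

section PathFactors

variable {V : Type*} {G F : SimpleGraph V}

theorem IsPathFactor.exists_adj (h : IsPathFactor G F 3) (v : V) : ∃ w, F.Adj v w := by
  obtain ⟨m, hm, ⟨φ⟩⟩ := h.2 (F.connectedComponentMk v)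
  let v' : F.connectedComponentMk v := ⟨v, rfl⟩
  obtain ⟨j, hj⟩ : ∃ j, (SimpleGraph.pathGraph m).Adj (φ v') j := by
    simp only [SimpleGraph.pathGraph_adj]
    by_cases hzero : (φ v').val = 0
    · exact ⟨⟨1, by lia⟩, by lia⟩
    · exact ⟨⟨(φ v').val - 1, by lia⟩, by lia⟩
  have hadj : (F.connectedComponentMk v).toSimpleGraph.Adj v' (φ.symm j) := by
    rwa [← φ.map_adj_iff, φ.apply_symm_apply]
  exact ⟨_, hadj⟩

theorem IsPathFactor.card_le_two_of_forall_adj {k : ℕ} (h : IsPathFactor G F k) {v : V}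
    {s : Finset V} (hs : ∀ w ∈ s, F.Adj v w) : s.card ≤ 2 := by
  obtain ⟨m, -, ⟨φ⟩⟩ := h.2 (F.connectedComponentMk v)
  have hmem (w : s) : w.1 ∈ F.connectedComponentMk v :=
    SimpleGraph.ConnectedComponent.sound (hs w w.2).symm.reachable
  let pos (w : s) : ℕ := φ ⟨w, hmem w⟩
  let i : ℕ := φ ⟨v, rfl⟩
  have hpos (w : s) : pos w ∈ ({i - 1, i + 1} : Finset ℕ) := by
    have hadj : i + 1 = pos w ∨ pos w + 1 = i := by
      rw [← SimpleGraph.pathGraph_adj, φ.map_adj_iff]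
      exact hs w w.2
    simp only [Finset.mem_insert, Finset.mem_singleton]
    lia
  have hinj : Function.Injective pos := fun w w' hw =>
    Subtype.ext (congrArg (fun z => z.1) (φ.injective (Fin.ext hw)))
  rw [← Finset.card_attach]
  exact (Finset.card_le_card_of_injOn pos (fun w _ => hpos w) hinj.injOn).trans Finset.card_le_two

theorem IsPathFactor.card_le_two_mul_card_compl [Fintype V] [DecidableEq V]
    (h : IsPathFactor G F 3) {A : Finset V} (hA : F.IsIndepSet A) : A.card ≤ 2 * Aᶜ.card := by
  choose f hf using h.exists_adj
  refine Finset.card_le_mul_card_image_of_maps_to (f := f) (fun v hv => ?_) 2 fun w _ => ?_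
  · rw [Finset.mem_compl]
    exact fun hfv => hA hv hfv (hf v).ne (hf v)
  · refine h.card_le_two_of_forall_adj (v := w) fun v hv => ?_
    rw [← (Finset.mem_filter.1 hv).2]
    exact (hf v).symm

theorem numComponents_eq_card_range {α : Type*} (f : V → α)
    (hf : ∀ v w, G.Reachable v w ↔ f v = f w) : numComponents G = Nat.card (Set.range f) :=
  Nat.card_congr ((Quot.congrRight hf).trans (Setoid.quotientKerEquivRange f))

end PathFactors

section Extremal

variable {a b : ℕ} {X : Finset (Fin a ⊕ (Fin b ⊕ Fin 2))}

/-- Labels the components of the graph left by removing the complete part of `extremalGraph a b`: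
`some j` is the `j`-th isolated vertex and `none` is the `K_2`. The label of a vertex of the
complete part is a dummy value. -/
def extremalLabel : Fin a ⊕ (Fin b ⊕ Fin 2) → Option (Fin b) :=
  Sum.elim (fun _ => none) (Sum.elim some fun _ => none)

theorem extremalGraph_adj_inl {i : Fin a} {v : Fin a ⊕ (Fin b ⊕ Fin 2)} :
    (extremalGraph a b).Adj (Sum.inl i) v ↔ v ≠ Sum.inl i := by
  rcases v with j | v
  · simp [extremalGraph, join, eq_comm]
  · simp [extremalGraph, join]

theorem extremalGraph_adj_inr {u v : Fin b ⊕ Fin 2} :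
    (extremalGraph a b).Adj (Sum.inr u) (Sum.inr v) ↔
      u ≠ v ∧ extremalLabel (Sum.inr u : Fin a ⊕ (Fin b ⊕ Fin 2)) =
        extremalLabel (Sum.inr v : Fin a ⊕ (Fin b ⊕ Fin 2)) := by
  rcases u with u | u <;> rcases v with v | v <;> simp [extremalGraph, join, extremalLabel]

theorem sym2_eq_of_extremalGraph_adj_inr {u v : Fin b ⊕ Fin 2}
    (huv : (extremalGraph a b).Adj (Sum.inr u) (Sum.inr v)) :
    s(u, v) = s(Sum.inr 0, Sum.inr 1) := by
  rw [extremalGraph_adj_inr] at huv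
  rcases u with u | u <;> rcases v with v | v
  · simp_all [extremalLabel]
  · simp_all [extremalLabel]
  · simp_all [extremalLabel]
  · fin_cases u <;> fin_cases v <;> simp_all [Sym2.eq_swap]

theorem connected_deleteVerts_extremalGraph {i : Fin a} (hi : Sum.inl i ∉ X) :
    (deleteVerts (extremalGraph a b) X).Connected := by
  refine (SimpleGraph.connected_iff_exists_forall_reachable _).2
    ⟨⟨Sum.inl i, by simpa using hi⟩, fun v => ?_⟩
  by_cases hv : v.1 = Sum.inl i
  · obtain rfl : v = ⟨Sum.inl i, by simpa using hi⟩ := Subtype.ext hv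
    rfl
  · exact SimpleGraph.Adj.reachable (extremalGraph_adj_inl.2 hv)

theorem card_le_of_forall_inl_mem (hX : ∀ i : Fin a, Sum.inl i ∈ X) : a ≤ X.card := by
  simpa using Finset.card_le_card_of_injOn (s := (Finset.univ : Finset (Fin a))) Sum.inl
    (fun i _ => hX i) Sum.inl_injective.injOn

theorem isVertexConnected_extremalGraph (a b : ℕ) : IsVertexConnected (extremalGraph a b) a := by
  refine ⟨by simp, fun X hX => ?_⟩
  obtain ⟨i, hi⟩ : ∃ i : Fin a, Sum.inl i ∉ X := by
    by_contra! hall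
    exact hX.not_ge (card_le_of_forall_inl_mem hall)
  exact connected_deleteVerts_extremalGraph hi

theorem adj_deleteVerts_extremalGraph_iff (hX : ∀ i : Fin a, Sum.inl i ∈ X)
    {v w : ((X : Set (Fin a ⊕ (Fin b ⊕ Fin 2)))ᶜ : Set _)} :
    (deleteVerts (extremalGraph a b) X).Adj v w ↔
      v ≠ w ∧ extremalLabel v.1 = extremalLabel w.1 := by
  obtain ⟨v | v, hv⟩ := v
  · exact absurd (hX v) (by simpa using hv)
  obtain ⟨w | w, hw⟩ := w
  · exact absurd (hX w) (by simpa using hw)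
  simp [extremalGraph_adj_inr]

theorem reachable_deleteVerts_extremalGraph_iff (hX : ∀ i : Fin a, Sum.inl i ∈ X)
    (v w : ((X : Set (Fin a ⊕ (Fin b ⊕ Fin 2)))ᶜ : Set _)) :
    (deleteVerts (extremalGraph a b) X).Reachable v w ↔
      extremalLabel v.1 = extremalLabel w.1 := by
  constructor
  · rintro ⟨p⟩
    induction p with
    | nil => rfl
    | cons hvw _ ih => exact ((adj_deleteVerts_extremalGraph_iff hX).1 hvw).2.trans ih
  · intro hlabel
    by_cases hvw : v = w
    · rw [hvw]
    · exact ((adj_deleteVerts_extremalGraph_iff hX).2 ⟨hvw, hlabel⟩).reachable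

theorem numComponents_deleteVerts_extremalGraph_le (hX : ∀ i : Fin a, Sum.inl i ∈ X) :
    numComponents (deleteVerts (extremalGraph a b) X) ≤ b + 1 := by
  rw [numComponents_eq_card_range _ (reachable_deleteVerts_extremalGraph_iff hX)]
  refine (Finite.card_subtype_le _).trans_eq ?_
  simp

theorem numComponents_deleteVerts_extremalGraph_map_inl (a b : ℕ) :
    numComponents (deleteVerts (extremalGraph a b)
      (Finset.univ.map Function.Embedding.inl)) = b + 1 := by
  rw [numComponents_eq_card_range _ (reachable_deleteVerts_extremalGraph_iff (by simp)),
    Function.Surjective.range_eq]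
  · simp
  · rintro (_ | j)
    · exact ⟨⟨Sum.inr (Sum.inr 0), by simp⟩, rfl⟩
    · exact ⟨⟨Sum.inr (Sum.inl j), by simp⟩, rfl⟩

theorem toughness_extremalGraph (a : ℕ) {b : ℕ} (hb : 1 ≤ b) :
    toughness (extremalGraph a b) = (a : ℝ≥0∞) / ((b : ℝ≥0∞) + 1) := by
  apply le_antisymm
  · have hnum := numComponents_deleteVerts_extremalGraph_map_inl a b
    refine (iInf₂_le (Finset.univ.map Function.Embedding.inl) (by lia)).trans_eq ?_
    rw [hnum, Finset.card_map, Finset.card_univ, Fintype.card_fin]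
    push_cast
    rfl
  · refine le_iInf₂ fun X hX => ?_
    have hall (i : Fin a) : Sum.inl i ∈ X := by
      by_contra hi
      have := (connected_deleteVerts_extremalGraph hi).preconnected.subsingleton_connectedComponent
      have hle : numComponents (deleteVerts (extremalGraph a b) X) ≤ 1 :=
        Finite.card_le_one_iff_subsingleton.2 this
      lia
    refine ENNReal.div_le_div ?_ ?_
    · exact_mod_cast card_le_of_forall_inl_mem hall
    · exact_mod_cast numComponents_deleteVerts_extremalGraph_le hall

theorem not_isPathFactorCriticalAvoidable_extremalGraph {n : ℕ} (hn : n ≤ a)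
    (hb : 2 * (a - n) < b + 2) : ¬ IsPathFactorCriticalAvoidable (extremalGraph a b) 3 n := by
  intro havoid
  obtain ⟨W, hWinl, hW⟩ := Finset.exists_subset_card_eq
    (s := (Finset.univ.map Function.Embedding.inl : Finset (Fin a ⊕ (Fin b ⊕ Fin 2)))) (n := n)
    (by simpa using hn)
  have hinr (u : Fin b ⊕ Fin 2) : Sum.inr u ∈ (W : Set (Fin a ⊕ (Fin b ⊕ Fin 2)))ᶜ :=
    fun hu => by simpa using hWinl hu
  let ι : Fin b ⊕ Fin 2 ↪ ((W : Set (Fin a ⊕ (Fin b ⊕ Fin 2)))ᶜ : Set _) :=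
    ⟨fun u => ⟨Sum.inr u, hinr u⟩, fun u v huv => Sum.inr_injective (congrArg Subtype.val huv)⟩
  obtain ⟨F, hF, heF⟩ := havoid W hW s(ι (Sum.inr 0), ι (Sum.inr 1))
    (extremalGraph_adj_inr.2 ⟨by simp, rfl⟩)
  have hindep : F.IsIndepSet (Finset.univ.map ι) := by
    rw [Finset.coe_map, Finset.coe_univ, Set.image_univ]
    rintro _ ⟨u, rfl⟩ _ ⟨v, rfl⟩ - huv
    have hedge : s(ι u, ι v) = s(ι (Sum.inr 0), ι (Sum.inr 1)) :=
      congrArg (Sym2.map ι) (sym2_eq_of_extremalGraph_adj_inr (hF.1 huv))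
    exact heF (hedge ▸ huv)
  have hcard := hF.card_le_two_mul_card_compl hindep
  have htotal : Fintype.card ((W : Set (Fin a ⊕ (Fin b ⊕ Fin 2)))ᶜ : Set _) = a + (b + 2) - n := by
    rw [Fintype.card_compl_set]
    simp [hW]
  rw [Finset.card_compl, htotal, Finset.card_map, Finset.card_univ, Fintype.card_sum,
    Fintype.card_fin, Fintype.card_fin] at hcard
  lia

end Extremal

end PathFactor

/-- The first conjunct is the sufficient condition, the second the sharpness of the toughness
bound, the third the sharpness of the connectivity assumption. -/
theorem theorem7 (n r : ℕ) :
    (∀ (V : Type*) [Fintype V] (G : SimpleGraph V),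
      PathFactor.IsVertexConnected G (n + r + 2) →
      ((n : ℝ≥0∞) + r + 2) / (2 * ((r : ℝ≥0∞) + 2)) < PathFactor.toughness G →
      PathFactor.IsPathFactorCriticalAvoidable G 3 n) ∧
    (PathFactor.IsVertexConnected
        (PathFactor.extremalGraph (n + r + 2) (2 * r + 3)) (n + r + 2) ∧
      PathFactor.toughness (PathFactor.extremalGraph (n + r + 2) (2 * r + 3)) =
        ((n : ℝ≥0∞) + r + 2) / (2 * ((r : ℝ≥0∞) + 2)) ∧
      ¬ PathFactor.IsPathFactorCriticalAvoidable
        (PathFactor.extremalGraph (n + r + 2) (2 * r + 3)) 3 n) ∧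
    (1 ≤ n →
      PathFactor.IsVertexConnected
        (PathFactor.extremalGraph (n + r + 1) (2 * r + 1)) (n + r + 1) ∧
      PathFactor.toughness (PathFactor.extremalGraph (n + r + 1) (2 * r + 1)) =
        ((n : ℝ≥0∞) + r + 1) / (2 * (r : ℝ≥0∞) + 2) ∧
      ((n : ℝ≥0∞) + r + 2) / (2 * ((r : ℝ≥0∞) + 2)) <
        PathFactor.toughness (PathFactor.extremalGraph (n + r + 1) (2 * r + 1)) ∧
      ¬ PathFactor.IsPathFactorCriticalAvoidable
        (PathFactor.extremalGraph (n + r + 1) (2 * r + 1)) 3 n) := by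
  refine ⟨fun V _ G hG ht => hG.isPathFactorCriticalAvoidable ht, ⟨?_, ?_, ?_⟩, fun hn => ?_⟩
  · exact PathFactor.isVertexConnected_extremalGraph _ _
  · rw [PathFactor.toughness_extremalGraph _ (by lia)]
    push_cast
    ring_nf
  · exact PathFactor.not_isPathFactorCriticalAvoidable_extremalGraph (by lia) (by lia)
  · have ht : PathFactor.toughness (PathFactor.extremalGraph (n + r + 1) (2 * r + 1)) =
        ((n : ℝ≥0∞) + r + 1) / (2 * (r : ℝ≥0∞) + 2) := by
      rw [PathFactor.toughness_extremalGraph _ (by lia)]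
      push_cast
      ring_nf
    refine ⟨PathFactor.isVertexConnected_extremalGraph _ _, ht, ht ▸ ?_,
      PathFactor.not_isPathFactorCriticalAvoidable_extremalGraph (by lia) (by lia)⟩
    have hlt : ((n + r + 2 : ℕ) : ℝ≥0∞) / ((2 * (r + 2) : ℕ) : ℝ≥0∞) <
        ((n + r + 1 : ℕ) : ℝ≥0∞) / ((2 * r + 2 : ℕ) : ℝ≥0∞) := by
      rw [← not_le, PathFactor.natCast_div_le_natCast_div_iff (by lia) (by lia)]
      nlinarith
    exact_mod_cast hlt
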